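/- **Setting.** Consider a finite chain of sites $1,\dots,N$ with Hilbert space $\bigotimes_{i=1}^N\mathbb C^{d_i}$. A time-dependent operator $B(t)=\sum_i B_i(t)$, given by its local terms $B_i(t)$, has *range* $r$ if each $B_i(t)$ acts nontrivially only on those of the sites $i,i+1,\dots,i+r-1$ that belong to the chain. Its *local norm* is $\|B\|_l=\sup_i\sup_t\|B_i(t)\|$, where $\|\cdot\|$ is the operator norm. The commutator $\mathrm{ad}_AB=[A,B]$ of $A=\sum_iA_i$ and $B=\sum_jB_j$ is written as a sum of local terms by attributing $[A_i,B_j]$ to its leftmost site: $(\mathrm{ad}_AB)_k=\sum_{\min(i,j)=k}[A_i,B_j]$. Sums and time integrals are taken term by term. Let $R\ge1$ be an integer, $T>0$, $h\ge0$, and let $H(t)=\sum_iH_i(t)$ have local terms that are measurable and $T$-periodic in $t\in\mathbb R$, with range $R$ and $\|H\|_l\le h$. Put $G^{(0)}=H$ and, recursively for $q\ge0$, $$\bar H^{(q)}=\frac1T\int_0^TG^{(q)}(t)\,dt,\qquad V^{(q)}(t)=G^{(q)}(t)-\bar H^{(q)},\qquad \Omega_{q+1}(t)=-i\int_0^tV^{(q)}(s)\,ds,$$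 where for $q\ge1$ $$G^{(q)}(t)=\sum_{k=1}^{q}\frac{(-1)^k}{k!}\sum_{\substack{1\le i_1,\dots,i_k\le q\\ i_1+\dots+i_k=q}}\mathrm{ad}_{\Omega_{i_1}}\cdots\mathrm{ad}_{\Omega_{i_k}}H(t)+\sum_{m=1}^{q}\sum_{k=1}^{q+1-m}\frac{(-1)^{k+1}}{(k+1)!}\sum_{\substack{1\le i_1,\dots,i_k\le q+1-m\\ i_1+\dots+i_k=q+1-m}}\mathrm{ad}_{\Omega_{i_1}}\cdots\mathrm{ad}_{\Omega_{i_k}}V^{(m-1)}(t).$$ **(a) Bounds on the gauge transformation.** There is a constant $C_0>0$, independent of $N$, $(d_i)$, $R$, $h$, $T$, $H$ and $q$, such that for all such data and all $q\ge0$ the following hold. 1. The local terms of $G^{(q)},\bar H^{(q)},V^{(q)},\Omega_{q+1}$ add up to the operators obtained by running the same recursion, with the ordinary commutator, from the operator $H(t)=\sum_iH_i(t)$. The local terms of $G^{(q)},V^{(q)},\Omega_{q+1}$ are $T$-periodic, and $i\,\partial_t\Omega_{q+1}(t)=V^{(q)}(t)$ at every $t$ at which $H$ is continuous. 2. $G^{(q)},\bar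 H^{(q)},V^{(q)},\Omega_{q+1}$ have range $R(q+1)$. 3. $\|G^{(q)}\|_l\le q!\,h\,(C_0RhT)^q$. 4. $\|\bar H^{(q)}\|_l\le\|G^{(q)}\|_l$ and $\|V^{(q)}\|_l\le2\|G^{(q)}\|_l$. 5. $\|\Omega_{q+1}\|_l\le T\|V^{(q)}\|_l\le2(C_0R)^q\,q!\,(hT)^{q+1}$. **(b) Combinatorial lemma.** There is a constant $C_0>0$ such that for all integers $R\ge1$ and $q\ge0$ $$\frac1{q!}\sum_{n=2}^{q+1}\frac{(C_0R)^{-n}}{n!}\sum_{I_1,\dots,I_n}\ \prod_{j=1}^n\Big(\frac{|I_j|}{R}-1\Big)!\ \le\ 1,$$ where the inner sum runs over all sequences $(I_1,\dots,I_n)$ of discrete intervals (finite sets of consecutive integers) in $\mathbb N$ such that every $|I_j|$ is a multiple of $R$, $I_j\cap\bigcup_{i<j}I_i\ne\emptyset$ for all $j>1$, $\sum_j|I_j|=R(q+1)$, and $\min\bigcup_jI_j=1$. -/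

import Mathlib

open scoped Matrix.Norms.L2Operator Kronecker

noncomputable section

namespace FloquetGauge

/-! ### Recursive gauge transformation for an arbitrary bracket

The recursion is written once, for a space `X` with a bracket `br` (so `ad_A B = br A B`).
It is used twice: for operators on the many-body Hilbert space with the commutator, and for
families of local terms with the bracket that the commutator induces on such families. -/

section Recursion

variable {X : Type*} [NormedAddCommGroup X] [NormedSpace ℂ X]

/-- Average over one period, `(1/T) ∫_0^T F(t) dt`. -/
def timeAvg (T : ℝ) (F : ℝ → X) : X := T⁻¹ • ∫ t in (0 : ℝ)..T, F t

/-- The part of `F` with zero average, `F(t) - (1/T) ∫_0^T F`. -/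
def oscPart (T : ℝ) (F : ℝ → X) (t : ℝ) : X := F t - timeAvg T F

/-- `-i ∫_0^t V(s) ds` with `V` the zero-average part of `F`. -/
def generator (T : ℝ) (F : ℝ → X) (t : ℝ) : X :=
  (-Complex.I) • ∫ s in (0 : ℝ)..t, oscPart T F s

/-- Tuples `(i_1, …, i_k)` with `1 ≤ i_j ≤ s` and `i_1 + … + i_k = s`. -/
def compositions (k s : ℕ) : Finset (Fin k → ℕ) :=
  (Fintype.piFinset fun _ : Fin k => Finset.Icc 1 s).filter fun i => ∑ j, i j = s

/-- `ad_{A_1} ad_{A_2} … ad_{A_k} B`. -/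
def nestedAd (br : X → X → X) {k : ℕ} (A : Fin k → X) (B : X) : X :=
  (List.ofFn A).foldr br B

/-- The right-hand side of the recursion at order `q ≥ 1`, as a function of the lower-order
`Ω_1, …, Ω_q` and `V^{(0)}, …, V^{(q-1)}`. The term `V^{(m-1)}` stands for `i ∂_t Ω_m`. -/
def gaugeStep (br : X → X → X) (H : ℝ → X) (Ω V : ℕ → ℝ → X) (q : ℕ) (t : ℝ) : X :=
  (∑ k ∈ Finset.Icc 1 q, ((-1 : ℂ) ^ k / (k.factorial : ℂ)) •
    ∑ i ∈ compositions k q, nestedAd br (fun j => Ω (i j) t) (H t)) +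
  ∑ m ∈ Finset.Icc 1 q, ∑ k ∈ Finset.Icc 1 (q + 1 - m),
    ((-1 : ℂ) ^ (k + 1) / ((k + 1).factorial : ℂ)) •
      ∑ i ∈ compositions k (q + 1 - m), nestedAd br (fun j => Ω (i j) t) (V (m - 1) t)

/-- `G^{(q)}`, by recursion on `q`, with `G^{(0)} = H`. See `gaugeG_zero`, `gaugeG_of_pos` for the
equations in closed form. -/
def gaugeG (br : X → X → X) (T : ℝ) (H : ℝ → X) (q : ℕ) : ℝ → X :=
  if q = 0 then H else
    gaugeStep br H
      (fun p => generator T (if _h : p - 1 < q then gaugeG br T H (p - 1) else 0))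
      (fun p => oscPart T (if _h : p < q then gaugeG br T H p else 0)) q
termination_by q

/-- `H̄^{(q)}`. -/
def gaugeHbar (br : X → X → X) (T : ℝ) (H : ℝ → X) (q : ℕ) : X :=
  timeAvg T (gaugeG br T H q)

/-- `V^{(q)} = G^{(q)} - H̄^{(q)}`. -/
def gaugeV (br : X → X → X) (T : ℝ) (H : ℝ → X) (q : ℕ) : ℝ → X :=
  oscPart T (gaugeG br T H q)

/-- `Ω_p(t) = -i ∫_0^t V^{(p-1)}(s) ds` for `p ≥ 1` (the value at `p = 0` is never used). -/
def gaugeΩ (br : X → X → X) (T : ℝ) (H : ℝ → X) (p : ℕ) : ℝ → X :=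
  generator T (gaugeG br T H (p - 1))

theorem gaugeG_zero (br : X → X → X) (T : ℝ) (H : ℝ → X) : gaugeG br T H 0 = H := by
  rw [gaugeG]; simp

theorem gaugeStep_congr (br : X → X → X) (H : ℝ → X) {Ω Ω' V V' : ℕ → ℝ → X} {q : ℕ}
    (hΩ : ∀ p, 1 ≤ p → p ≤ q → Ω p = Ω' p) (hV : ∀ p, p < q → V p = V' p) :
    gaugeStep br H Ω V q = gaugeStep br H Ω' V' q := by
  funext t
  have key : ∀ k s, s ≤ q → ∀ i ∈ compositions k s,
      (fun j => Ω (i j) t) = fun j => Ω' (i j) t := by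
    intro k s hs i hi
    funext j
    simp only [compositions, Finset.mem_filter, Fintype.mem_piFinset, Finset.mem_Icc] at hi
    rw [hΩ _ (hi.1 j).1 ((hi.1 j).2.trans hs)]
  unfold gaugeStep
  congr 1
  · refine Finset.sum_congr rfl fun k _ => ?_
    congr 1
    refine Finset.sum_congr rfl fun i hi => ?_
    rw [key k q le_rfl i hi]
  · refine Finset.sum_congr rfl fun m hm => Finset.sum_congr rfl fun k _ => ?_
    rw [Finset.mem_Icc] at hm
    congr 1
    refine Finset.sum_congr rfl fun i hi => ?_
    rw [key k _ (by omega) i hi, hV (m - 1) (by omega)]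

theorem gaugeG_of_pos (br : X → X → X) (T : ℝ) (H : ℝ → X) {q : ℕ} (hq : 1 ≤ q) :
    gaugeG br T H q = gaugeStep br H (gaugeΩ br T H) (gaugeV br T H) q := by
  rw [gaugeG, if_neg (by omega)]
  refine gaugeStep_congr br H (fun p hp hpq => ?_) (fun p hp => ?_)
  · simp only [gaugeΩ]; rw [dif_pos (by omega)]
  · simp only [gaugeV]; rw [dif_pos hp]

end Recursion

/-! ### Operators on a finite chain -/

/-- Operators on `⨂_{i < N} ℂ^{d i}`, as matrices in the product basis, with the operator norm
for the Hilbert space norm. -/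
abbrev Op {N : ℕ} (d : Fin N → ℕ) : Type :=
  Matrix (∀ i, Fin (d i)) (∀ i, Fin (d i)) ℂ

/-- `A` acts nontrivially only on the sites in `S`: `A = a ⊗ 1` with respect to the splitting of
the chain into `S` and its complement. -/
def SupportedOn {N : ℕ} {d : Fin N → ℕ} (A : Op d) (S : Finset (Fin N)) : Prop :=
  ∃ a : Matrix (∀ i : {i // i ∈ S}, Fin (d i)) (∀ i : {i // i ∈ S}, Fin (d i)) ℂ,
    A = (a ⊗ₖ (1 : Matrix (∀ i : {i // i ∉ S}, Fin (d i)) (∀ i : {i // i ∉ S}, Fin (d i)) ℂ)).submatrix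
      (Equiv.piEquivPiSubtypeProd (fun i => i ∈ S) fun i => Fin (d i))
      (Equiv.piEquivPiSubtypeProd (fun i => i ∈ S) fun i => Fin (d i))

/-- The sites `i, i+1, …, i+r-1` (those that belong to the chain). -/
def siteInterval {N : ℕ} (i : Fin N) (r : ℕ) : Finset (Fin N) :=
  Finset.univ.filter fun j => i ≤ j ∧ (j : ℕ) < i + r

/-- A time-dependent family of local terms `B_i(t)` has range `r`. -/
def HasRange {N : ℕ} {d : Fin N → ℕ} (B : ℝ → Fin N → Op d) (r : ℕ) : Prop :=
  ∀ t i, SupportedOn (B t i) (siteInterval i r)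

/-- `‖B‖_l = sup_i sup_t ‖B_i(t)‖`, with values in `[0, ∞]`. -/
def localNorm {N : ℕ} {d : Fin N → ℕ} (B : ℝ → Fin N → Op d) : ENNReal :=
  ⨆ i, ⨆ t, ‖B t i‖ₑ

/-- The operator `∑_i B_i` of a family of local terms. -/
def total {N : ℕ} {d : Fin N → ℕ} (B : Fin N → Op d) : Op d := ∑ i, B i

/-- The commutator. -/
def opComm {N : ℕ} {d : Fin N → ℕ} (A B : Op d) : Op d := A * B - B * A

/-- The local terms of `[∑_i A_i, ∑_j B_j]`: the commutator `[A_i, B_j]` is attributed to its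
leftmost site `min i j`. (Commutators of terms with disjoint supports vanish.) -/
def localBracket {N : ℕ} {d : Fin N → ℕ} (A B : Fin N → Op d) : Fin N → Op d := fun k =>
  ∑ p ∈ (Finset.univ : Finset (Fin N × Fin N)) with min p.1 p.2 = k, opComm (A p.1) (B p.2)

/-! ### Overlapping sequences of intervals -/

/-- Sequences `I_1, …, I_n` of discrete intervals whose lengths are multiples of `R` and add up to
`R (q+1)`, such that each interval meets the union of the preceding ones and the union of all of
them has minimum `1`. -/
def overlapSeqs (R q n : ℕ) : Set (Fin n → Finset ℕ) :=
  {I | (∀ j, ∃ a b, I j = Finset.Icc a b) ∧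
    (∀ j, R ∣ (I j).card) ∧
    (∀ j : Fin n, 0 < (j : ℕ) → ∃ i, i < j ∧ (I j ∩ I i).Nonempty) ∧
    ∑ j, (I j).card = R * (q + 1) ∧
    IsLeast (⋃ j, (I j : Set ℕ)) 1}

theorem overlapSeqs_finite (R q n : ℕ) : (overlapSeqs R q n).Finite := by
  set S := R * (q + 1) with hS
  refine Set.Finite.subset (Set.Finite.pi' (t := fun _ : Fin n =>
    (((Finset.range (1 + (2 * n + 1) * S + 1)).powerset : Finset (Finset ℕ)) : Set (Finset ℕ)))
    fun _ => Finset.finite_toSet _) ?_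
  rintro I ⟨hint, -, hmeet, hsum, h1, -⟩
  have hdist : ∀ j, ∀ x ∈ I j, ∀ y ∈ I j, x ≤ y + S := by
    intro j x hx y hy
    have hc : (I j).card ≤ S := by
      rw [hS, ← hsum]
      exact Finset.single_le_sum (f := fun j => (I j).card) (fun _ _ => Nat.zero_le _)
        (Finset.mem_univ j)
    obtain ⟨a, b, hab⟩ := hint j
    rw [hab] at hx hy hc
    rw [Nat.card_Icc] at hc
    rw [Finset.mem_Icc] at hx hy
    omega
  have hchain : ∀ m : ℕ, ∀ j : Fin n, (j : ℕ) = m → ∀ x ∈ I j, ∃ z : Fin n, (z : ℕ) = 0 ∧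
      ∃ y ∈ I z, x ≤ y + m * S ∧ y ≤ x + m * S := by
    intro m
    induction m using Nat.strong_induction_on with
    | _ m ih =>
      intro j hj x hx
      rcases Nat.eq_zero_or_pos m with h0 | hpos
      · exact ⟨j, by omega, x, hx, by omega, by omega⟩
      · obtain ⟨i, hij, w, hw⟩ := hmeet j (by omega)
        rw [Finset.mem_inter] at hw
        have him : (i : ℕ) < m := by rw [← hj]; exact hij
        obtain ⟨z, hz, y, hy, h2, h3⟩ := ih i him i rfl w hw.2
        have h4 := hdist j x hx w hw.1
        have h5 := hdist j w hw.1 x hx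
        have h6 : ((i : ℕ) + 1) * S ≤ m * S := Nat.mul_le_mul_right _ him
        rw [Nat.add_mul, Nat.one_mul] at h6
        exact ⟨z, hz, y, hy, by omega, by omega⟩
  obtain ⟨j₁, hj₁⟩ := Set.mem_iUnion.1 h1
  obtain ⟨z₁, hz₁, y₁, hy₁, -, h3⟩ := hchain _ j₁ rfl 1 (by simpa using hj₁)
  intro j
  simp only [Finset.coe_powerset, Set.mem_preimage, Set.mem_powerset_iff]
  intro x hx
  obtain ⟨z, hz, y, hy, h4, -⟩ := hchain _ j rfl x (by simpa using hx)
  have hzz : z = z₁ := Fin.ext (by omega)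
  subst hzz
  have h5 := hdist z y hy y₁ hy₁
  have h6 : (j : ℕ) * S ≤ n * S := Nat.mul_le_mul_right _ j.2.le
  have h7 : (j₁ : ℕ) * S ≤ n * S := Nat.mul_le_mul_right _ j₁.2.le
  have h8 : (2 * n + 1) * S = n * S + n * S + S := by ring
  simp only [Finset.coe_range, Set.mem_Iio]
  omega

/-- The sum over interval sequences of `∏_j (|I_j|/R - 1)!`. -/
def overlapSum (R q n : ℕ) : ℝ :=
  ∑ I ∈ (overlapSeqs_finite R q n).toFinset, ∏ j, (((I j).card / R - 1).factorial : ℝ)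

end FloquetGauge

end

/-! The local terms `B : Fin N → Op d`, with the sup norm, form a finite-dimensional normed space on
which `localBracket` is a continuous bilinear map, and `total` carries it to the commutator. Hence
everything qualitative is proved once, for a continuous bilinear bracket on a Banach space: bounded
measurable periodic functions are stable under the recursion (`gaugeG_mem_bddPeriodic`), generators
are continuous and periodic because the oscillating part has zero average, and a bracket homomorphism
intertwines the recursions (`map_gaugeG`).

The quantitative part rests on locality. If `A` has range `a` and `B` has range `b`, a local term of
`[A, B]` is a sum of at most `a + b` nonzero commutators, so that
`‖[A, B]‖ ≤ 2 (a + b) ‖A‖ ‖B‖` (`norm_localBracket_le`), and `[A, B]` has range `a + b`. The bounds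
of order `(p - 1)!` for the generators of lower order therefore give nested commutators of total order
`q` a bound by convolutions of factorials in which every convolution carries a factor at most `q + 1`.
These stay of order `q!`, up to a constant power, since
`(q + 1) ∑_{m = 1}^q (m - 1)! (q - m)! ≤ 6 q!` (`succ_mul_sum_factorial_le`, `sum_nestWeight_le`).
With generators carrying a small prefactor, of order `1 / R`, the sum over the number of commutators
is a geometric series, and the induction on `q` closes (`norm_gaugeStep_le`).

The sum over interval sequences obeys the same convolution inequality: removing the last of `n + 2`
intervals leaves a shorter admissible sequence, up to translation, and the removed interval had at
most `R (q + 1)` positions (`overlapSum_succ_le`). -/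

noncomputable section

namespace FloquetGauge

open MeasureTheory

/-! ### Convolutions of factorials -/

/-- Recursion for `∑_j j! (n - j)!`, from
`(j + 1)! (n - j)! + j! (n - j + 1)! = (n + 2) j! (n - j)!`. -/
theorem two_mul_sum_factorial_mul_factorial_succ (n : ℕ) :
    2 * ∑ j ∈ Finset.range (n + 2), j.factorial * (n + 1 - j).factorial =
      (n + 2) * ∑ j ∈ Finset.range (n + 1), j.factorial * (n - j).factorial +
        2 * (n + 1).factorial := by
  have h1 : ∑ j ∈ Finset.range (n + 2), j.factorial * (n + 1 - j).factorial =
      ∑ j ∈ Finset.range (n + 1), (j + 1).factorial * (n - j).factorial + (n + 1).factorial := by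
    rw [Finset.sum_range_succ']
    simp
  have h2 : ∑ j ∈ Finset.range (n + 2), j.factorial * (n + 1 - j).factorial =
      ∑ j ∈ Finset.range (n + 1), j.factorial * (n + 1 - j).factorial + (n + 1).factorial := by
    rw [Finset.sum_range_succ]
    simp
  have h3 : ∑ j ∈ Finset.range (n + 1), (j + 1).factorial * (n - j).factorial +
      ∑ j ∈ Finset.range (n + 1), j.factorial * (n + 1 - j).factorial =
      (n + 2) * ∑ j ∈ Finset.range (n + 1), j.factorial * (n - j).factorial := by
    rw [← Finset.sum_add_distrib, Finset.mul_sum]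
    refine Finset.sum_congr rfl fun j hj => ?_
    obtain ⟨l, rfl⟩ := Nat.exists_eq_add_of_le (Nat.lt_succ_iff.1 (Finset.mem_range.1 hj))
    rw [show j + l + 1 - j = l + 1 by omega, show j + l - j = l by omega, Nat.factorial_succ,
      Nat.factorial_succ]
    ring
  omega

theorem sum_factorial_mul_factorial_le (n : ℕ) :
    ∑ j ∈ Finset.range (n + 1), j.factorial * (n - j).factorial ≤ 3 * n.factorial := by
  induction n with
  | zero => simp
  | succ n ih =>
    rcases Nat.lt_or_ge n 2 with hn | hn
    · interval_cases n <;> simp [Finset.sum_range_succ, Nat.factorial]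
    · have h := two_mul_sum_factorial_mul_factorial_succ n
      rw [Nat.factorial_succ] at h ⊢
      nlinarith [Nat.mul_le_mul_left (n + 2) ih,
        Nat.mul_le_mul_right n.factorial (show 3 * n + 6 ≤ 4 * n + 4 by omega)]

/-- Factorial weights are almost stable under convolution: the extra factor `q + 1`, which counts
the relative positions of two overlapping intervals, costs only a constant. -/
theorem succ_mul_sum_factorial_le (q : ℕ) :
    (q + 1) * ∑ m ∈ Finset.Icc 1 q, (m - 1).factorial * (q - m).factorial ≤ 6 * q.factorial := by
  rcases q with _ | n
  · simp
  · have h : ∑ m ∈ Finset.Icc 1 (n + 1), (m - 1).factorial * (n + 1 - m).factorial =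
        ∑ j ∈ Finset.range (n + 1), j.factorial * (n - j).factorial := by
      refine Finset.sum_nbij' (· - 1) (· + 1) ?_ ?_ ?_ ?_ ?_
      · intro m hm; simp only [Finset.mem_Icc, Finset.mem_range] at *; omega
      · intro m hm; simp only [Finset.mem_Icc, Finset.mem_range] at *; omega
      · intro m hm; simp only [Finset.mem_Icc] at *; omega
      · intro m hm; simp
      · intro m hm
        rw [Finset.mem_Icc] at hm
        rw [show n - (m - 1) = n + 1 - m by omega]
    rw [h, Nat.factorial_succ]
    nlinarith [Nat.mul_le_mul_left (n + 2) (sum_factorial_mul_factorial_le n)]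

/-- `∑ (m - 1)! ∏ (i_j - 1)! ∏_j (m + i_k + … + i_j)` over the tuples `(i_1, …, i_k)` of positive
integers with sum `s`: what the norm of a sum of `k`-fold nested commutators of total order `s`
picks up from the norms of the entries and from the number of overlapping local terms. -/
def nestWeight : ℕ → ℕ → ℕ → ℝ
  | 0, m, s => if s = 0 then ((m - 1).factorial : ℝ) else 0
  | k + 1, m, s => ((m : ℝ) + s) * ∑ a ∈ Finset.Icc 1 s,
      ((a - 1).factorial : ℝ) * nestWeight k m (s - a)

theorem nestWeight_nonneg (k m s : ℕ) : 0 ≤ nestWeight k m s := by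
  induction k generalizing s with
  | zero => rw [nestWeight]; positivity
  | succ k ih =>
    rw [nestWeight]
    exact mul_nonneg (by positivity) (Finset.sum_nonneg fun a _ => mul_nonneg (by positivity) (ih _))

theorem sum_nestWeight_le (k q : ℕ) :
    ∑ m ∈ Finset.Icc 1 (q + 1), nestWeight k m (q + 1 - m) ≤ 6 ^ k * (q.factorial : ℝ) := by
  induction k generalizing q with
  | zero =>
    rw [Finset.sum_eq_single (q + 1)]
    · simp [nestWeight]
    · intro m hm hne
      rw [Finset.mem_Icc] at hm
      rw [nestWeight, if_neg (by omega)]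
    · intro h; simp at h
  | succ k ih =>
    have hstep : ∑ m ∈ Finset.Icc 1 (q + 1), nestWeight (k + 1) m (q + 1 - m) =
        (q + 1 : ℝ) * ∑ a ∈ Finset.Icc 1 q, ((a - 1).factorial : ℝ) *
          ∑ m ∈ Finset.Icc 1 (q - a + 1), nestWeight k m (q - a + 1 - m) := by
      simp_rw [Finset.mul_sum]
      rw [Finset.sum_comm' (t' := Finset.Icc 1 (q + 1))
        (s' := fun m => Finset.Icc 1 (q + 1 - m))]
      · refine Finset.sum_congr rfl fun m hm => ?_
        rw [Finset.mem_Icc] at hm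
        rw [nestWeight, Finset.mul_sum, Nat.cast_sub hm.2]
        refine Finset.sum_congr rfl fun a ha => ?_
        rw [Finset.mem_Icc] at ha
        rw [show q - a + 1 - m = q + 1 - m - a by omega]
        push_cast
        ring
      · intro a m
        simp only [Finset.mem_Icc]
        omega
    have hconv : (q + 1 : ℝ) * ∑ a ∈ Finset.Icc 1 q, ((a - 1).factorial : ℝ) *
        ((q - a).factorial : ℝ) ≤ 6 * (q.factorial : ℝ) := by
      exact_mod_cast succ_mul_sum_factorial_le q
    calc _ ≤ (q + 1 : ℝ) * ∑ a ∈ Finset.Icc 1 q, ((a - 1).factorial : ℝ) *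
          (6 ^ k * ((q - a).factorial : ℝ)) := by
          rw [hstep]
          gcongr with a ha
          exact ih _
      _ = 6 ^ k * ((q + 1 : ℝ) * ∑ a ∈ Finset.Icc 1 q, ((a - 1).factorial : ℝ) *
          ((q - a).factorial : ℝ)) := by
          simp only [Finset.mul_sum]
          refine Finset.sum_congr rfl fun a _ => by ring
      _ ≤ 6 ^ k * (6 * (q.factorial : ℝ)) := by gcongr
      _ = _ := by ring

theorem nestWeight_one_le (k q : ℕ) : nestWeight k 1 q ≤ 6 ^ k * (q.factorial : ℝ) := by
  refine le_trans ?_ (sum_nestWeight_le k q)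
  have := Finset.single_le_sum (f := fun m => nestWeight k m (q + 1 - m))
    (fun m _ => nestWeight_nonneg _ _ _) (show 1 ∈ Finset.Icc 1 (q + 1) by simp)
  simpa using this

theorem sum_Icc_pow_le {x : ℝ} (hx0 : 0 ≤ x) (hx : x < 1) (n : ℕ) :
    ∑ k ∈ Finset.Icc 1 n, x ^ k ≤ x / (1 - x) := by
  have h := geom_sum_Ico_le_of_lt_one (m := 1) (n := n + 1) hx0 hx
  rwa [pow_one] at h

/-! ### Overlapping sequences of intervals -/

/-- The summand of `overlapSum`. -/
def seqWeight (R : ℕ) {n : ℕ} (I : Fin n → Finset ℕ) : ℝ :=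
  ∏ j, (((I j).card / R - 1).factorial : ℝ)

/-- Adjoin to a sequence `J` of intervals with joint minimum `1` a further interval, of `l` points
and with right end `c`, and shift everything to the right by the number of points of the new interval
that would lie below `1`. -/
def snocInterval {n : ℕ} (l : ℕ) (J : Fin n → Finset ℕ) (c : ℕ) : Fin (n + 1) → Finset ℕ :=
  Fin.snoc (α := fun _ => Finset ℕ) (fun i => (J i).image (· + (l - c)))
    (Finset.Icc (c + 1 + (l - c) - l) (c + (l - c)))

theorem seqWeight_nonneg (R : ℕ) {n : ℕ} (I : Fin n → Finset ℕ) : 0 ≤ seqWeight R I :=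
  Finset.prod_nonneg fun _ _ => by positivity

theorem seqWeight_snocInterval {R : ℕ} (hR : 1 ≤ R) {n : ℕ} (m : ℕ) (J : Fin n → Finset ℕ)
    (c : ℕ) : seqWeight R (snocInterval (R * m) J c) = ((m - 1).factorial : ℝ) * seqWeight R J := by
  have hc : (Finset.Icc (c + 1 + (R * m - c) - R * m) (c + (R * m - c))).card / R = m := by
    rw [Nat.card_Icc, show c + (R * m - c) + 1 - (c + 1 + (R * m - c) - R * m) = R * m by omega,
      Nat.mul_div_cancel_left _ hR]
  simp only [seqWeight, snocInterval, Fin.prod_univ_castSucc, Fin.snoc_castSucc, Fin.snoc_last, hc]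
  rw [mul_comm]
  congr 1
  refine Finset.prod_congr rfl fun i _ => ?_
  rw [Finset.card_image_of_injective _ (add_left_injective _)]

theorem exists_fin_succ_iff_castSucc {n : ℕ} {P : Fin (n + 1) → Prop} :
    (∃ j, P j) ↔ (∃ j : Fin n, P j.castSucc) ∨ P (Fin.last n) := by
  constructor
  · rintro ⟨j, hj⟩
    induction j using Fin.lastCases with
    | last => exact Or.inr hj
    | cast j => exact Or.inl ⟨j, hj⟩
  · rintro (⟨j, hj⟩ | h)
    exacts [⟨_, hj⟩, ⟨_, h⟩]

/-- The union of a sequence of overlapping intervals is an interval, at most as long as all of them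
together. -/
theorem exists_union_eq_Icc {n : ℕ} (I : Fin (n + 1) → Finset ℕ)
    (hint : ∀ j, ∃ a b, I j = Finset.Icc a b)
    (hmeet : ∀ j : Fin (n + 1), 0 < (j : ℕ) → ∃ i, i < j ∧ (I j ∩ I i).Nonempty)
    (h0 : (I 0).Nonempty) :
    ∃ a b, (∀ x, (∃ j, x ∈ I j) ↔ a ≤ x ∧ x ≤ b) ∧ a ≤ b ∧ b + 1 ≤ a + ∑ j, (I j).card := by
  induction n with
  | zero =>
    obtain ⟨a, b, hab⟩ := hint 0
    rw [hab, Finset.nonempty_Icc] at h0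
    refine ⟨a, b, fun x => ?_, h0, ?_⟩
    · rw [Fin.exists_fin_one, hab, Finset.mem_Icc]
    · rw [Fin.sum_univ_one, hab, Nat.card_Icc]
      omega
  | succ n ih =>
    obtain ⟨a, b, hU, hab, hlen⟩ := ih (fun i => I i.castSucc) (fun j => hint _) (by
      intro j hj
      obtain ⟨i, hij, hi⟩ := hmeet j.castSucc hj
      have hin : (i : ℕ) < n + 1 := lt_trans (Fin.lt_def.1 hij) j.2
      exact ⟨i.castLT hin, Fin.lt_def.2 (Fin.lt_def.1 hij), by simpa using hi⟩) h0
    obtain ⟨x, y, hxy⟩ := hint (Fin.last _)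
    obtain ⟨i, hi, w, hw⟩ := hmeet (Fin.last _) (by simp)
    rw [Finset.mem_inter, hxy, Finset.mem_Icc] at hw
    have hwU := (hU w).1 ⟨i.castLT (Fin.lt_def.1 hi), by simpa using hw.2⟩
    refine ⟨min a x, max b y, fun z => ?_, by omega, ?_⟩
    · rw [exists_fin_succ_iff_castSucc, hU, hxy, Finset.mem_Icc]
      omega
    · rw [Fin.sum_univ_castSucc, hxy, Nat.card_Icc]
      omega

/-- Every admissible sequence arises from a shorter one by adjoining its last interval; the right
end of that interval has at most `R * (q + 1)` possible positions. -/
theorem exists_eq_snocInterval {R q n : ℕ} (hR : 1 ≤ R) {I : Fin (n + 2) → Finset ℕ}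
    (hI : I ∈ overlapSeqs R q (n + 2)) :
    ∃ m ∈ Finset.Icc 1 q, ∃ J ∈ overlapSeqs R (q - m) (n + 1), ∃ c ∈ Finset.range (R * (q + 1)),
      I = snocInterval (R * m) J c := by
  obtain ⟨hint, hdvd, hmeet, hsum, hleast⟩ := hI
  have h0 : (I 0).Nonempty := by
    obtain ⟨i, hi, hne⟩ := hmeet 1 (by simp)
    have : i = 0 := Fin.ext (by have := Fin.lt_def.1 hi; simpa using this)
    subst this
    exact hne.mono Finset.inter_subset_right
  have hmeet' : ∀ j : Fin (n + 1), 0 < (j : ℕ) →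
      ∃ i, i < j ∧ (I j.castSucc ∩ I i.castSucc).Nonempty := by
    intro j hj
    obtain ⟨i, hij, hi⟩ := hmeet j.castSucc hj
    have hin : (i : ℕ) < n + 1 := lt_trans (Fin.lt_def.1 hij) j.2
    exact ⟨i.castLT hin, Fin.lt_def.2 (Fin.lt_def.1 hij), by simpa using hi⟩
  obtain ⟨u, b, hU, hub, hlen⟩ :=
    exists_union_eq_Icc (fun i => I i.castSucc) (fun j => hint _) hmeet' h0
  obtain ⟨a, e, hae⟩ := hint (Fin.last _)
  obtain ⟨i₀, hi₀, w, hw⟩ := hmeet (Fin.last _) (by simp)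
  rw [Finset.mem_inter, hae, Finset.mem_Icc] at hw
  have hwU := (hU w).1 ⟨i₀.castLT (Fin.lt_def.1 hi₀), by simpa using hw.2⟩
  obtain ⟨m, hm⟩ := hdvd (Fin.last _)
  rw [hae, Nat.card_Icc] at hm
  rw [Fin.sum_univ_castSucc, hae, Nat.card_Icc, hm] at hsum
  -- The last interval is `[a, e]`, the others cover exactly `[u, b]`. The shorter sequence is obtained
  -- from the latter by a shift by `u - 1`; the position `e + 1 - u` recovers this shift, because
  -- either `u = 1`, or `a = 1` and the last interval has `u - 1` points to the left of `u`.
  have hU1 : min u a = 1 := by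
    have h1 : ∃ j, 1 ∈ I j := by simpa using hleast.1
    have h2 : ∀ j, ∀ x ∈ I j, 1 ≤ x := fun j x hx =>
      hleast.2 (Set.mem_iUnion.2 ⟨j, hx⟩)
    rw [exists_fin_succ_iff_castSucc, hU, hae, Finset.mem_Icc] at h1
    have h3 := h2 (Fin.last _) a (by rw [hae, Finset.mem_Icc]; omega)
    obtain ⟨j, hj⟩ := (hU u).2 ⟨le_rfl, hub⟩
    have h4 := h2 _ _ hj
    omega
  have hge : ∀ i : Fin (n + 1), ∀ x ∈ I i.castSucc, u ≤ x := fun i x hx => ((hU x).1 ⟨i, hx⟩).1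
  have hmpos : 1 ≤ m := by
    rcases Nat.eq_zero_or_pos m with h | h
    · subst h; omega
    · exact h
  have hmq : m ≤ q := by
    have h1 : R ≤ (I (Fin.castSucc 0)).card := Nat.le_of_dvd (Finset.card_pos.2 h0) (hdvd _)
    have h2 : (I (Fin.castSucc 0)).card ≤ ∑ i : Fin (n + 1), (I i.castSucc).card :=
      Finset.single_le_sum (f := fun i : Fin (n + 1) => (I i.castSucc).card)
        (fun _ _ => Nat.zero_le _) (Finset.mem_univ _)
    by_contra hlt
    have h3 : R * (q + 1) ≤ R * m := Nat.mul_le_mul_left _ (by omega)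
    omega
  have hinj : ∀ i : Fin (n + 1), Set.InjOn (· - (u - 1)) (I i.castSucc : Set ℕ) := by
    intro i x hx y hy hxy
    have h1 := hge i x hx
    have h2 := hge i y hy
    simp only at hxy
    omega
  have hRm : R * (q - m + 1) + R * m = R * (q + 1) := by
    rw [← Nat.mul_add]; congr 1; omega
  refine ⟨m, Finset.mem_Icc.2 ⟨hmpos, hmq⟩, fun i => (I i.castSucc).image (· - (u - 1)),
    ⟨fun j => ?_, fun j => ?_, fun j hj => ?_, ?_, ?_, ?_⟩, e + 1 - u, ?_, ?_⟩
  · obtain ⟨x, y, hxy⟩ := hint j.castSucc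
    refine ⟨x - (u - 1), y - (u - 1), ?_⟩
    have hne : (I j.castSucc).Nonempty := by
      rcases Nat.eq_zero_or_pos (j : ℕ) with h | h
      · rwa [show j.castSucc = 0 from Fin.ext h]
      · obtain ⟨i, -, hi⟩ := hmeet j.castSucc h
        exact hi.mono Finset.inter_subset_left
    rw [hxy, Finset.nonempty_Icc] at hne
    have hx : u ≤ x := hge j x (by rw [hxy, Finset.mem_Icc]; omega)
    ext z
    simp only [hxy, Finset.mem_image, Finset.mem_Icc]
    constructor
    · rintro ⟨z, hz, rfl⟩; omega
    · intro hz
      exact ⟨z + (u - 1), by omega, by omega⟩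
  · rw [Finset.card_image_of_injOn (hinj j)]
    exact hdvd _
  · obtain ⟨i, hij, z, hz⟩ := hmeet' j hj
    rw [Finset.mem_inter] at hz
    exact ⟨i, hij, z - (u - 1), Finset.mem_inter.2
      ⟨Finset.mem_image_of_mem _ hz.1, Finset.mem_image_of_mem _ hz.2⟩⟩
  · rw [Finset.sum_congr rfl fun i _ => Finset.card_image_of_injOn (hinj i)]
    omega
  · obtain ⟨j, hj⟩ := (hU u).2 ⟨le_rfl, hub⟩
    refine Set.mem_iUnion.2 ⟨j, Finset.mem_coe.2 (Finset.mem_image.2 ⟨u, hj, by omega⟩)⟩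
  · intro z hz
    obtain ⟨j, hj⟩ := Set.mem_iUnion.1 hz
    obtain ⟨x, hx, rfl⟩ := Finset.mem_image.1 (Finset.mem_coe.1 hj)
    have := hge j x hx
    omega
  · rw [Finset.mem_range]
    omega
  · have hshift : R * m - (e + 1 - u) = u - 1 := by omega
    funext j
    refine Fin.lastCases ?_ (fun i => ?_) j
    · rw [snocInterval, Fin.snoc_last, hae, hshift]
      congr 1 <;> omega
    · rw [snocInterval, Fin.snoc_castSucc, hshift, Finset.image_image]
      ext z
      simp only [Finset.mem_image, Function.comp]
      constructor
      · intro hz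
        have := hge i z hz
        exact ⟨z, hz, by omega⟩
      · rintro ⟨z', hz', rfl⟩
        have := hge i z' hz'
        rwa [show z' - (u - 1) + (u - 1) = z' by omega]

theorem overlapSum_eq (R q n : ℕ) :
    overlapSum R q n = ∑ I ∈ (overlapSeqs_finite R q n).toFinset, seqWeight R I := rfl

theorem overlapSum_succ_le {R : ℕ} (hR : 1 ≤ R) (q n : ℕ) :
    overlapSum R q (n + 2) ≤ (R * (q + 1) : ℝ) *
      ∑ m ∈ Finset.Icc 1 q, ((m - 1).factorial : ℝ) * overlapSum R (q - m) (n + 1) := by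
  classical
  set D : Finset (Σ _ : ℕ, (Fin (n + 1) → Finset ℕ) × ℕ) := (Finset.Icc 1 q).sigma fun m =>
    (overlapSeqs_finite R (q - m) (n + 1)).toFinset ×ˢ Finset.range (R * (q + 1)) with hD
  set g : (Σ _ : ℕ, (Fin (n + 1) → Finset ℕ) × ℕ) → Fin (n + 2) → Finset ℕ := fun x =>
    snocInterval (R * x.1) x.2.1 x.2.2 with hg
  have hsub : (overlapSeqs_finite R q (n + 2)).toFinset ⊆ D.image g := by
    intro I hI
    obtain ⟨m, hm, J, hJ, c, hc, rfl⟩ :=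
      exists_eq_snocInterval hR ((Set.Finite.mem_toFinset _).1 hI)
    exact Finset.mem_image.2 ⟨⟨m, J, c⟩, Finset.mem_sigma.2
      ⟨hm, Finset.mem_product.2 ⟨(Set.Finite.mem_toFinset _).2 hJ, hc⟩⟩, rfl⟩
  calc overlapSum R q (n + 2) ≤ ∑ I ∈ D.image g, seqWeight R I :=
        Finset.sum_le_sum_of_subset_of_nonneg hsub fun I _ _ => seqWeight_nonneg R I
    _ ≤ ∑ x ∈ D, seqWeight R (g x) :=
        Finset.sum_image_le_of_nonneg fun I _ => seqWeight_nonneg R I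
    _ = _ := by
        rw [hD, Finset.sum_sigma, Finset.mul_sum]
        refine Finset.sum_congr rfl fun m _ => ?_
        simp only [hg, seqWeight_snocInterval hR]
        rw [Finset.sum_product, overlapSum_eq]
        simp only [Finset.sum_const, Finset.card_range, nsmul_eq_mul, ← Finset.mul_sum]
        push_cast
        ring

theorem overlapSum_one_le {R : ℕ} (hR : 1 ≤ R) (q : ℕ) : overlapSum R q 1 ≤ q.factorial := by
  have hsub : (overlapSeqs_finite R q 1).toFinset ⊆ {fun _ => Finset.Icc 1 (R * (q + 1))} := by
    intro I hI
    obtain ⟨hint, -, -, hsum, hleast⟩ := (Set.Finite.mem_toFinset _).1 hI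
    obtain ⟨a, b, hab⟩ := hint 0
    have h1 : 1 ∈ I 0 := by simpa using hleast.1
    have h2 : 1 ≤ a := hleast.2 (Set.mem_iUnion.2 ⟨0, by
      rw [hab, Finset.mem_Icc] at h1
      rw [hab, Finset.mem_coe, Finset.mem_Icc]; omega⟩)
    rw [hab, Finset.mem_Icc] at h1
    rw [Fin.sum_univ_one, hab, Nat.card_Icc] at hsum
    rw [Finset.mem_singleton]
    funext j
    rw [Subsingleton.elim j 0, hab]
    congr 1 <;> omega
  refine (Finset.sum_le_sum_of_subset_of_nonneg hsub
    fun I _ _ => seqWeight_nonneg R I).trans ?_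
  simp [seqWeight, Nat.mul_div_cancel_left _ hR]

theorem overlapSum_le {R : ℕ} (hR : 1 ≤ R) (n q : ℕ) :
    overlapSum R q (n + 1) ≤ (6 * R : ℝ) ^ n * q.factorial := by
  induction n generalizing q with
  | zero => simpa using overlapSum_one_le hR q
  | succ n ih =>
    have hconv : (q + 1 : ℝ) * ∑ m ∈ Finset.Icc 1 q, ((m - 1).factorial : ℝ) *
        ((q - m).factorial : ℝ) ≤ 6 * (q.factorial : ℝ) := by
      exact_mod_cast succ_mul_sum_factorial_le q
    calc _ ≤ (R * (q + 1) : ℝ) * ∑ m ∈ Finset.Icc 1 q, ((m - 1).factorial : ℝ) *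
          ((6 * R : ℝ) ^ n * ((q - m).factorial : ℝ)) := by
          refine (overlapSum_succ_le hR q n).trans ?_
          gcongr with m hm
          exact ih _
      _ = R * (6 * R : ℝ) ^ n * ((q + 1 : ℝ) * ∑ m ∈ Finset.Icc 1 q, ((m - 1).factorial : ℝ) *
          ((q - m).factorial : ℝ)) := by
          simp only [Finset.mul_sum]
          refine Finset.sum_congr rfl fun m _ => by ring
      _ ≤ R * (6 * R : ℝ) ^ n * (6 * (q.factorial : ℝ)) := by gcongr
      _ = _ := by ring

/-- By `overlapSum_le` the `n`-th summand is at most `q! (6 R) ^ n (12 R) ^ (-n) = q! 2⁻ⁿ`. -/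
theorem sum_overlapSum_le {R : ℕ} (hR : 1 ≤ R) (q : ℕ) :
    1 / (q.factorial : ℝ) * ∑ n ∈ Finset.Icc 2 (q + 1),
      ((12 : ℝ) * R) ^ (-(n : ℤ)) / (n.factorial : ℝ) * overlapSum R q n ≤ 1 := by
  have hR' : (1 : ℝ) ≤ R := by exact_mod_cast hR
  have hterm : ∀ n ∈ Finset.Icc 2 (q + 1),
      ((12 : ℝ) * R) ^ (-(n : ℤ)) / (n.factorial : ℝ) * overlapSum R q n ≤
        (1 / 2 : ℝ) ^ n * q.factorial := by
    intro n hn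
    obtain ⟨k, rfl⟩ : ∃ k, n = k + 1 := ⟨n - 1, by rw [Finset.mem_Icc] at hn; omega⟩
    have hf : (1 : ℝ) ≤ ((k + 1).factorial : ℝ) := by exact_mod_cast Nat.factorial_pos (k + 1)
    rw [zpow_neg, zpow_natCast]
    calc (((12 : ℝ) * R) ^ (k + 1))⁻¹ / ((k + 1).factorial : ℝ) * overlapSum R q (k + 1)
        ≤ (((12 : ℝ) * R) ^ (k + 1))⁻¹ * ((6 * R : ℝ) ^ (k + 1) * q.factorial) := by
          refine mul_le_mul (div_le_self (by positivity) hf) ((overlapSum_le hR k q).trans ?_)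
            (Finset.sum_nonneg fun I _ => seqWeight_nonneg R I) (by positivity)
          gcongr
          · linarith
          · omega
      _ = (1 / 2 : ℝ) ^ (k + 1) * q.factorial := by
          rw [show (12 : ℝ) * R = 2 * (6 * R) by ring, mul_pow, one_div, inv_pow]
          field_simp
  have hsub : ∑ n ∈ Finset.Icc 2 (q + 1), (1 / 2 : ℝ) ^ n ≤ 1 := by
    refine le_trans (Finset.sum_le_sum_of_subset_of_nonneg
      (Finset.Icc_subset_Icc_left one_le_two) fun _ _ _ => by positivity)
      ((sum_Icc_pow_le (x := 1 / 2) (by norm_num) (by norm_num) (q + 1)).trans (by norm_num))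
  have hq : (0 : ℝ) < q.factorial := by exact_mod_cast q.factorial_pos
  rw [one_div, inv_mul_le_iff₀ hq, mul_one]
  refine (Finset.sum_le_sum hterm).trans ?_
  rw [← Finset.sum_mul]
  exact mul_le_of_le_one_left hq.le hsub

/-! ### Sums of nested commutators -/

theorem mem_compositions {k s : ℕ} {i : Fin k → ℕ} :
    i ∈ compositions k s ↔ (∀ j, 1 ≤ i j) ∧ ∑ j, i j = s := by
  simp only [compositions, Finset.mem_filter, Fintype.mem_piFinset, Finset.mem_Icc]
  refine ⟨fun h => ⟨fun j => (h.1 j).1, h.2⟩, fun h => ⟨fun j => ⟨h.1 j, ?_⟩, h.2⟩⟩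
  rw [← h.2]
  exact Finset.single_le_sum (fun _ _ => Nat.zero_le _) (Finset.mem_univ j)

theorem sum_compositions_succ {M : Type*} [AddCommMonoid M] (k s : ℕ) (f : (Fin (k + 1) → ℕ) → M) :
    ∑ i ∈ compositions (k + 1) s, f i =
      ∑ a ∈ Finset.Icc 1 s, ∑ i ∈ compositions k (s - a), f (Fin.cons a i) := by
  rw [Finset.sum_sigma']
  symm
  refine Finset.sum_nbij' (fun x => Fin.cons x.1 x.2)
    (fun i => (⟨i 0, Fin.tail i⟩ : Σ _ : ℕ, Fin k → ℕ)) ?_ ?_ ?_ ?_ ?_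
  · rintro ⟨a, i⟩ h
    simp only [Finset.mem_sigma, Finset.mem_Icc, mem_compositions] at h
    refine mem_compositions.2 ⟨fun j => ?_, ?_⟩
    · induction j using Fin.cases with
      | zero => exact h.1.1
      | succ j => exact h.2.1 j
    · rw [Fin.sum_univ_succ]
      change a + ∑ j, i j = s
      omega
  · intro i h
    rw [mem_compositions, Fin.sum_univ_succ] at h
    have h0 := h.1 0
    simp only [Finset.mem_sigma, Finset.mem_Icc, mem_compositions]
    refine ⟨by omega, fun j => h.1 j.succ, ?_⟩
    simp only [Fin.tail]
    omega
  · rintro ⟨a, i⟩ h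
    simp
  · intro i h
    simp
  · rintro ⟨a, i⟩ h
    rfl

theorem nestedAd_zero {X : Type*} (br : X → X → X) (A : Fin 0 → X) (B : X) : nestedAd br A B = B := rfl

theorem nestedAd_succ {X : Type*} (br : X → X → X) {k : ℕ} (A : Fin (k + 1) → X) (B : X) :
    nestedAd br A B = br (A 0) (nestedAd br (fun j => A j.succ) B) := by
  simp [nestedAd, List.ofFn_succ]

section Recursion

variable {X : Type*} [NormedAddCommGroup X] {Y : Type*} [NormedAddCommGroup Y]

/-- `∑ ad_{Ω_{i_1}} ⋯ ad_{Ω_{i_k}} B` over the tuples of positive integers with sum `s`. -/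
def nestSum (br : X → X → X) (Ω : ℕ → X) (k s : ℕ) (B : X) : X :=
  ∑ i ∈ compositions k s, nestedAd br (fun j => Ω (i j)) B

theorem nestSum_zero (br : X → X → X) (Ω : ℕ → X) (s : ℕ) (B : X) :
    nestSum br Ω 0 s B = if s = 0 then B else 0 := by
  rw [nestSum]
  split_ifs with h
  · rw [show compositions 0 s = Finset.univ from
      Finset.eq_univ_iff_forall.2 fun i => mem_compositions.2 ⟨fun j => j.elim0, by simp [h]⟩]
    simp [nestedAd_zero]
  · rw [Finset.sum_eq_zero]
    intro i hi
    exact absurd (by simpa using (mem_compositions.1 hi).2.symm) h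

variable [NormedSpace ℂ X] [NormedSpace ℂ Y]

theorem nestSum_succ (br : X →L[ℂ] X →L[ℂ] X) (Ω : ℕ → X) (k s : ℕ) (B : X) :
    nestSum (fun x y => br x y) Ω (k + 1) s B =
      ∑ a ∈ Finset.Icc 1 s, br (Ω a) (nestSum (fun x y => br x y) Ω k (s - a) B) := by
  rw [nestSum, sum_compositions_succ]
  refine Finset.sum_congr rfl fun a _ => ?_
  rw [nestSum, map_sum]
  refine Finset.sum_congr rfl fun i _ => ?_
  rw [nestedAd_succ]
  simp

theorem gaugeStep_eq_nestSum (br : X → X → X) (H : ℝ → X) (Ω V : ℕ → ℝ → X) (q : ℕ) (t : ℝ) :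
    gaugeStep br H Ω V q t =
      (∑ k ∈ Finset.Icc 1 q, ((-1 : ℂ) ^ k / (k.factorial : ℂ)) •
        nestSum br (fun p => Ω p t) k q (H t)) +
      ∑ m ∈ Finset.Icc 1 q, ∑ k ∈ Finset.Icc 1 (q + 1 - m),
        ((-1 : ℂ) ^ (k + 1) / ((k + 1).factorial : ℂ)) •
          nestSum br (fun p => Ω p t) k (q + 1 - m) (V (m - 1) t) := rfl

theorem map_gaugeStep {br : X → X → X} {br' : Y → Y → Y} (L : X →L[ℂ] Y)
    (hL : ∀ x y, L (br x y) = br' (L x) (L y)) (H : ℝ → X) (Ω V : ℕ → ℝ → X) (q : ℕ) (t : ℝ) :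
    L (gaugeStep br H Ω V q t) =
      gaugeStep br' (fun t => L (H t)) (fun p t => L (Ω p t)) (fun p t => L (V p t)) q t := by
  have hnest : ∀ (k : ℕ) (A : Fin k → X) (B : X),
      L (nestedAd br A B) = nestedAd br' (fun j => L (A j)) (L B) := by
    intro k
    induction k with
    | zero => intro A B; rfl
    | succ k ih => intro A B; rw [nestedAd_succ, nestedAd_succ, hL, ih]
  simp only [gaugeStep, map_add, map_sum, map_smul, hnest]

/-! ### Regularity of the recursion -/

/-- A space of functions of time that is stable under the bracket is stable under the recursion. -/
theorem gaugeStep_mem {br : X → X → X} (S : Submodule ℂ (ℝ → X))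
    (hbr : ∀ F ∈ S, ∀ G ∈ S, (fun t => br (F t) (G t)) ∈ S) {H : ℝ → X} {Ω V : ℕ → ℝ → X} {q : ℕ}
    (hH : H ∈ S) (hΩ : ∀ p, 1 ≤ p → p ≤ q → Ω p ∈ S) (hV : ∀ p, p < q → V p ∈ S) :
    gaugeStep br H Ω V q ∈ S := by
  have hnest : ∀ (k : ℕ) (i : Fin k → ℕ), (∀ j, 1 ≤ i j ∧ i j ≤ q) → ∀ B ∈ S,
      (fun t => nestedAd br (fun j => Ω (i j) t) (B t)) ∈ S := by
    intro k
    induction k with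
    | zero => intro i _ B hB; exact hB
    | succ k ih =>
      intro i hi B hB
      simp only [nestedAd_succ]
      exact hbr _ (hΩ _ (hi 0).1 (hi 0).2) _ (ih (fun j => i j.succ) (fun j => hi j.succ) B hB)
  have hcomp : ∀ k s, s ≤ q → ∀ i ∈ compositions k s, ∀ j, 1 ≤ i j ∧ i j ≤ q := by
    intro k s hs i hi j
    simp only [compositions, Finset.mem_filter, Fintype.mem_piFinset, Finset.mem_Icc] at hi
    exact ⟨(hi.1 j).1, (hi.1 j).2.trans hs⟩
  have hfun : gaugeStep br H Ω V q =
      (∑ k ∈ Finset.Icc 1 q, ((-1 : ℂ) ^ k / (k.factorial : ℂ)) •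
        ∑ i ∈ compositions k q, fun t => nestedAd br (fun j => Ω (i j) t) (H t)) +
      ∑ m ∈ Finset.Icc 1 q, ∑ k ∈ Finset.Icc 1 (q + 1 - m),
        ((-1 : ℂ) ^ (k + 1) / ((k + 1).factorial : ℂ)) •
          ∑ i ∈ compositions k (q + 1 - m),
            fun t => nestedAd br (fun j => Ω (i j) t) (V (m - 1) t) := by
    funext t
    simp [gaugeStep]
  rw [hfun]
  refine S.add_mem (S.sum_mem fun k _ => S.smul_mem _ (S.sum_mem fun i hi => ?_))
    (S.sum_mem fun m hm => S.sum_mem fun k _ => S.smul_mem _ (S.sum_mem fun i hi => ?_))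
  · exact hnest k i (hcomp k q le_rfl i hi) H hH
  · rw [Finset.mem_Icc] at hm
    exact hnest k i (hcomp k _ (by omega) i hi) _ (hV _ (by omega))

variable (X) in
/-- The strongly measurable, bounded, `T`-periodic functions of time. -/
def bddPeriodic (T : ℝ) : Submodule ℂ (ℝ → X) where
  carrier := {F | StronglyMeasurable F ∧ (∃ C, ∀ t, ‖F t‖ ≤ C) ∧ Function.Periodic F T}
  add_mem' := by
    rintro F G ⟨hF, ⟨C, hC⟩, hFT⟩ ⟨hG, ⟨D, hD⟩, hGT⟩
    exact ⟨hF.add hG, ⟨C + D, fun t => (norm_add_le _ _).trans (add_le_add (hC t) (hD t))⟩,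
      hFT.add hGT⟩
  zero_mem' := ⟨stronglyMeasurable_zero, ⟨0, fun t => by simp⟩, fun t => rfl⟩
  smul_mem' := by
    rintro c F ⟨hF, ⟨C, hC⟩, hFT⟩
    exact ⟨hF.const_smul c, ⟨‖c‖ * C, fun t => by
      rw [Pi.smul_apply, norm_smul]; gcongr; exact hC t⟩, hFT.smul c⟩

theorem bddPeriodic_const (T : ℝ) (c : X) : (fun _ => c) ∈ bddPeriodic X T :=
  ⟨stronglyMeasurable_const, ⟨‖c‖, fun _ => le_rfl⟩, fun _ => rfl⟩

theorem bddPeriodic_bilin (br : X →L[ℂ] X →L[ℂ] X) {T : ℝ} {F G : ℝ → X}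
    (hF : F ∈ bddPeriodic X T) (hG : G ∈ bddPeriodic X T) :
    (fun t => br (F t) (G t)) ∈ bddPeriodic X T := by
  obtain ⟨hF, ⟨C, hC⟩, hFT⟩ := hF
  obtain ⟨hG, ⟨D, hD⟩, hGT⟩ := hG
  refine ⟨?_, ⟨‖br‖ * C * D, fun t => ?_⟩, fun t => by simp only [hFT t, hGT t]⟩
  · have h : Continuous fun p : X × X => br p.1 p.2 := by fun_prop
    exact h.comp_stronglyMeasurable (hF.prodMk hG)
  · refine (br.le_opNorm₂ _ _).trans ?_
    have h1 := hC t
    have h2 := hD t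
    have h3 : 0 ≤ C := (norm_nonneg _).trans h1
    gcongr

theorem intervalIntegrable_of_mem_bddPeriodic {T : ℝ} {F : ℝ → X} (hF : F ∈ bddPeriodic X T)
    (a b : ℝ) : IntervalIntegrable F volume a b := by
  obtain ⟨hF, ⟨C, hC⟩, -⟩ := hF
  rw [intervalIntegrable_iff]
  exact Measure.integrableOn_of_bounded (by simp) hF.aestronglyMeasurable
    (Filter.Eventually.of_forall hC)

theorem oscPart_mem_bddPeriodic {T : ℝ} {F : ℝ → X} (hF : F ∈ bddPeriodic X T) :
    oscPart T F ∈ bddPeriodic X T :=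
  (bddPeriodic X T).sub_mem hF (bddPeriodic_const T _)

theorem norm_timeAvg_le {T : ℝ} (hT : 0 < T) {F : ℝ → X} {C : ℝ} (hC : ∀ t, ‖F t‖ ≤ C) :
    ‖timeAvg T F‖ ≤ C := by
  have h := intervalIntegral.norm_integral_le_of_norm_le_const (a := 0) (b := T)
    (f := F) (C := C) fun t _ => hC t
  rw [sub_zero, abs_of_pos hT] at h
  rw [timeAvg, norm_smul, norm_inv, Real.norm_of_nonneg hT.le, inv_mul_le_iff₀ hT]
  linarith

theorem norm_oscPart_le {T : ℝ} (hT : 0 < T) {F : ℝ → X} {C : ℝ} (hC : ∀ t, ‖F t‖ ≤ C) (t : ℝ) :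
    ‖oscPart T F t‖ ≤ 2 * C := by
  have h1 := norm_sub_le (F t) (timeAvg T F)
  have h2 := norm_timeAvg_le hT hC
  have h3 := hC t
  rw [oscPart]
  linarith

theorem continuous_generator {T : ℝ} {F : ℝ → X} (hF : F ∈ bddPeriodic X T) :
    Continuous (generator T F) :=
  (intervalIntegral.continuous_primitive
    (intervalIntegrable_of_mem_bddPeriodic (oscPart_mem_bddPeriodic hF)) 0).const_smul _

variable [CompleteSpace X]

theorem integral_oscPart_eq_zero {T : ℝ} (hT : 0 < T) {F : ℝ → X} (hF : F ∈ bddPeriodic X T) :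
    ∫ s in (0 : ℝ)..T, oscPart T F s = 0 := by
  simp only [oscPart]
  rw [intervalIntegral.integral_sub (intervalIntegrable_of_mem_bddPeriodic hF _ _)
    intervalIntegrable_const, intervalIntegral.integral_const, timeAvg, smul_smul, sub_zero,
    mul_inv_cancel₀ hT.ne', one_smul, sub_self]

theorem periodic_generator {T : ℝ} (hT : 0 < T) {F : ℝ → X} (hF : F ∈ bddPeriodic X T) :
    Function.Periodic (generator T F) T := by
  intro t
  have hV := oscPart_mem_bddPeriodic hF
  have h := hV.2.2.intervalIntegral_add_eq t 0
  rw [zero_add, integral_oscPart_eq_zero hT hF] at h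
  rw [generator, generator, ← intervalIntegral.integral_add_adjacent_intervals
    (intervalIntegrable_of_mem_bddPeriodic hV 0 t)
    (intervalIntegrable_of_mem_bddPeriodic hV t (t + T)), h, add_zero]

theorem norm_generator_le {T : ℝ} (hT : 0 < T) {F : ℝ → X} (hF : F ∈ bddPeriodic X T) {C : ℝ}
    (hC : ∀ t, ‖oscPart T F t‖ ≤ C) (t : ℝ) : ‖generator T F t‖ ≤ T * C := by
  obtain ⟨s, hs, hst⟩ := (periodic_generator hT hF).exists_mem_Ico₀ hT t
  have hC0 : 0 ≤ C := (norm_nonneg _).trans (hC 0)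
  have h := intervalIntegral.norm_integral_le_of_norm_le_const (a := 0) (b := s)
    (f := oscPart T F) (C := C) fun t _ => hC t
  rw [sub_zero, abs_of_nonneg hs.1] at h
  rw [hst, generator, norm_smul, norm_neg, Complex.norm_I, one_mul]
  nlinarith [hs.2]

theorem generator_mem_bddPeriodic {T : ℝ} (hT : 0 < T) {F : ℝ → X} (hF : F ∈ bddPeriodic X T) :
    generator T F ∈ bddPeriodic X T := by
  obtain ⟨C, hC⟩ := (oscPart_mem_bddPeriodic hF).2.1
  exact ⟨(continuous_generator hF).stronglyMeasurable, ⟨_, norm_generator_le hT hF hC⟩,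
    periodic_generator hT hF⟩

theorem gaugeG_mem_bddPeriodic (br : X →L[ℂ] X →L[ℂ] X) {T : ℝ} (hT : 0 < T) {H : ℝ → X}
    (hH : H ∈ bddPeriodic X T) (q : ℕ) :
    gaugeG (fun x y => br x y) T H q ∈ bddPeriodic X T := by
  induction q using Nat.strong_induction_on with
  | _ q ih =>
    rcases Nat.eq_zero_or_pos q with rfl | hq
    · rwa [gaugeG_zero]
    · rw [gaugeG_of_pos _ _ _ hq]
      exact gaugeStep_mem _ (fun F hF G hG => bddPeriodic_bilin br hF hG) hH
        (fun p h1 h2 => generator_mem_bddPeriodic hT (ih _ (by omega)))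
        (fun p hp => oscPart_mem_bddPeriodic (ih _ hp))

/-- All `G^{(q)}` are continuous wherever `H` is, because the generators are continuous. -/
theorem continuousAt_gaugeG (br : X →L[ℂ] X →L[ℂ] X) {T : ℝ} (hT : 0 < T) {H : ℝ → X}
    (hH : H ∈ bddPeriodic X T) {t : ℝ} (ht : ContinuousAt H t) (q : ℕ) :
    ContinuousAt (gaugeG (fun x y => br x y) T H q) t := by
  let S : Submodule ℂ (ℝ → X) :=
    { carrier := {F | ContinuousAt F t}
      add_mem' := fun hF hG => ContinuousAt.add hF hG
      zero_mem' := continuousAt_const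
      smul_mem' := fun c _ hF => ContinuousAt.const_smul hF c }
  induction q using Nat.strong_induction_on with
  | _ q ih =>
    rcases Nat.eq_zero_or_pos q with rfl | hq
    · rwa [gaugeG_zero]
    · rw [gaugeG_of_pos _ _ _ hq]
      refine gaugeStep_mem S (fun F hF G hG => ?_) ht
        (fun p h1 h2 => (continuous_generator (gaugeG_mem_bddPeriodic br hT hH _)).continuousAt)
        (fun p hp => (ih _ hp).sub continuousAt_const)
      have h : Continuous fun p : X × X => br p.1 p.2 := by fun_prop
      exact h.continuousAt.comp (ContinuousAt.prodMk (show ContinuousAt F t from hF) hG)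

theorem hasDerivAt_generator {T : ℝ} {F : ℝ → X} (hF : F ∈ bddPeriodic X T) {t : ℝ}
    (ht : ContinuousAt F t) :
    HasDerivAt (generator T F) ((-Complex.I) • oscPart T F t) t := by
  have hV := oscPart_mem_bddPeriodic hF
  exact (intervalIntegral.integral_hasDerivAt_right
    (intervalIntegrable_of_mem_bddPeriodic hV 0 t)
    hV.1.stronglyMeasurableAtFilter (ht.sub continuousAt_const)).const_smul _

/-! ### Transport of the recursion along linear maps -/

variable [CompleteSpace Y]

theorem map_timeAvg (L : X →L[ℂ] Y) {T : ℝ} {F : ℝ → X} (hF : F ∈ bddPeriodic X T) :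
    L (timeAvg T F) = timeAvg T fun t => L (F t) := by
  rw [timeAvg, timeAvg, L.map_smul_of_tower,
    ← L.intervalIntegral_comp_comm (intervalIntegrable_of_mem_bddPeriodic hF _ _)]

theorem map_oscPart (L : X →L[ℂ] Y) {T : ℝ} {F : ℝ → X} (hF : F ∈ bddPeriodic X T) (t : ℝ) :
    L (oscPart T F t) = oscPart T (fun t => L (F t)) t := by
  rw [oscPart, oscPart, map_sub, map_timeAvg L hF]

theorem map_generator (L : X →L[ℂ] Y) {T : ℝ} {F : ℝ → X} (hF : F ∈ bddPeriodic X T) (t : ℝ) :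
    L (generator T F t) = generator T (fun t => L (F t)) t := by
  rw [generator, generator, map_smul, ← L.intervalIntegral_comp_comm
    (intervalIntegrable_of_mem_bddPeriodic (oscPart_mem_bddPeriodic hF) _ _)]
  simp only [map_oscPart L hF]

/-- A bracket homomorphism intertwines the two recursions. -/
theorem map_gaugeG (br : X →L[ℂ] X →L[ℂ] X) {br' : Y → Y → Y} (L : X →L[ℂ] Y)
    (hL : ∀ x y, L (br x y) = br' (L x) (L y)) {T : ℝ} (hT : 0 < T) {H : ℝ → X}
    (hH : H ∈ bddPeriodic X T) (q : ℕ) :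
    (fun t => L (gaugeG (fun x y => br x y) T H q t)) = gaugeG br' T (fun t => L (H t)) q := by
  induction q using Nat.strong_induction_on with
  | _ q ih =>
    rcases Nat.eq_zero_or_pos q with rfl | hq
    · rw [gaugeG_zero, gaugeG_zero]
    · rw [gaugeG_of_pos _ _ _ hq, gaugeG_of_pos _ _ _ hq]
      funext t
      rw [map_gaugeStep L hL]
      refine congrFun (gaugeStep_congr _ _ (fun p h1 h2 => ?_) (fun p hp => ?_)) t
      · funext s
        rw [gaugeΩ, gaugeΩ, map_generator L (gaugeG_mem_bddPeriodic br hT hH _), ih _ (by omega)]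
      · funext s
        rw [gaugeV, gaugeV, map_oscPart L (gaugeG_mem_bddPeriodic br hT hH _), ih _ hp]

/-! ### Averages with values in a subspace -/

/-- A linear projection onto `p` is continuous in finite dimension, so it commutes with the integral. -/
theorem intervalIntegral_mem_of_finiteDimensional [FiniteDimensional ℂ X] (p : Submodule ℂ X)
    {F : ℝ → X} (hp : ∀ t, F t ∈ p) {a b : ℝ} (hF : IntervalIntegrable F volume a b) :
    ∫ t in a..b, F t ∈ p := by
  obtain ⟨g, hg⟩ := LinearMap.exists_extend (LinearMap.id : p →ₗ[ℂ] p)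
  have hgp : ∀ x, x ∈ p → (g x : X) = x := fun x hx =>
    congrArg Subtype.val (LinearMap.congr_fun hg ⟨x, hx⟩)
  let L : X →L[ℂ] X := (p.subtype ∘ₗ g).toContinuousLinearMap
  have hL := L.intervalIntegral_comp_comm hF
  rw [show (fun t => L (F t)) = F from funext fun t => hgp _ (hp t)] at hL
  rw [hL]
  exact (g _).2

variable [FiniteDimensional ℂ X]

theorem timeAvg_mem (p : Submodule ℂ X) {T : ℝ} {F : ℝ → X} (hF : F ∈ bddPeriodic X T)
    (hp : ∀ t, F t ∈ p) : timeAvg T F ∈ p :=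
  p.smul_of_tower_mem _ (intervalIntegral_mem_of_finiteDimensional p hp
    (intervalIntegrable_of_mem_bddPeriodic hF _ _))

theorem oscPart_mem (p : Submodule ℂ X) {T : ℝ} {F : ℝ → X} (hF : F ∈ bddPeriodic X T)
    (hp : ∀ t, F t ∈ p) (t : ℝ) : oscPart T F t ∈ p :=
  p.sub_mem (hp t) (timeAvg_mem p hF hp)

theorem generator_mem (p : Submodule ℂ X) {T : ℝ} {F : ℝ → X} (hF : F ∈ bddPeriodic X T)
    (hp : ∀ t, F t ∈ p) (t : ℝ) : generator T F t ∈ p :=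
  p.smul_mem _ (intervalIntegral_mem_of_finiteDimensional p (oscPart_mem p hF hp)
    (intervalIntegrable_of_mem_bddPeriodic (oscPart_mem_bddPeriodic hF) _ _))

end Recursion

/-! ### Supports of operators -/

section Chain

variable {N : ℕ} {d : Fin N → ℕ}

/-- Description of `SupportedOn` by matrix entries: the entry between two configurations vanishes
unless they agree off `S`, and then depends only on their restrictions to `S`. -/
theorem supportedOn_iff {A : Op d} {S : Finset (Fin N)} :
    SupportedOn A S ↔ (∀ x y, (∃ i, i ∉ S ∧ x i ≠ y i) → A x y = 0) ∧
      ∀ x y x' y', (∀ i, i ∉ S → x i = y i) → (∀ i, i ∉ S → x' i = y' i) →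
        (∀ i ∈ S, x i = x' i) → (∀ i ∈ S, y i = y' i) → A x y = A x' y' := by
  constructor
  · rintro ⟨a, rfl⟩
    refine ⟨?_, ?_⟩
    · rintro x y ⟨i, hi, hne⟩
      rw [Matrix.submatrix_apply, Matrix.kroneckerMap_apply, Matrix.one_apply_ne, mul_zero]
      intro h
      exact hne (congrFun h ⟨i, hi⟩)
    · intro x y x' y' h h' hx hy
      have h1 : ∀ z z' : (∀ i, Fin (d i)), (∀ i ∈ S, z i = z' i) →
          (Equiv.piEquivPiSubtypeProd (fun i => i ∈ S) (fun i => Fin (d i)) z).1 =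
          (Equiv.piEquivPiSubtypeProd (fun i => i ∈ S) (fun i => Fin (d i)) z').1 :=
        fun z z' hz => funext fun i => hz i i.2
      have h2 : ∀ z z' : (∀ i, Fin (d i)), (∀ i, i ∉ S → z i = z' i) →
          (Equiv.piEquivPiSubtypeProd (fun i => i ∈ S) (fun i => Fin (d i)) z).2 =
          (Equiv.piEquivPiSubtypeProd (fun i => i ∈ S) (fun i => Fin (d i)) z').2 :=
        fun z z' hz => funext fun i => hz i i.2
      rw [Matrix.submatrix_apply, Matrix.submatrix_apply, Matrix.kroneckerMap_apply,
        Matrix.kroneckerMap_apply, h1 x x' hx, h1 y y' hy, h2 x y h, h2 x' y' h',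
        Matrix.one_apply_eq, Matrix.one_apply_eq]
  · rintro ⟨h0, h1⟩
    classical
    set e := Equiv.piEquivPiSubtypeProd (fun i => i ∈ S) (fun i => Fin (d i)) with he
    have hS : ∀ u w i (hi : i ∈ S), e.symm (u, w) i = u ⟨i, hi⟩ := fun u w i hi => by
      simp [he, Equiv.piEquivPiSubtypeProd, hi]
    have hS' : ∀ u w i (hi : i ∉ S), e.symm (u, w) i = w ⟨i, hi⟩ := fun u w i hi => by
      simp [he, Equiv.piEquivPiSubtypeProd, hi]
    -- The complement of `S` may have no configuration at all; then every operator vanishes.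
    refine ⟨Matrix.of fun u v => if h : Nonempty (∀ i : {i // i ∉ S}, Fin (d i)) then
      A (e.symm (u, h.some)) (e.symm (v, h.some)) else 0, ?_⟩
    ext x y
    rw [Matrix.submatrix_apply, Matrix.kroneckerMap_apply]
    by_cases hxy : (e x).2 = (e y).2
    · have hne : Nonempty (∀ i : {i // i ∉ S}, Fin (d i)) := ⟨(e x).2⟩
      rw [hxy, Matrix.one_apply_eq, mul_one, Matrix.of_apply, dif_pos hne]
      refine h1 _ _ _ _ (fun i hi => congrFun hxy ⟨i, hi⟩) (fun i hi => ?_) (fun i hi => ?_)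
        (fun i hi => ?_)
      · rw [hS' _ _ _ hi, hS' _ _ _ hi]
      · rw [hS _ _ _ hi]; rfl
      · rw [hS _ _ _ hi]; rfl
    · rw [Matrix.one_apply_ne hxy, mul_zero]
      obtain ⟨⟨i, hi⟩, hne⟩ := Function.ne_iff.1 hxy
      exact h0 x y ⟨i, hi, hne⟩

/-- The operators acting nontrivially only on the sites in `S`. -/
def supportedSubmodule (d : Fin N → ℕ) (S : Finset (Fin N)) : Submodule ℂ (Op d) where
  carrier := {A | SupportedOn A S}
  add_mem' := by
    rintro _ _ ⟨a, rfl⟩ ⟨b, rfl⟩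
    exact ⟨a + b, by rw [Matrix.add_kronecker, Matrix.submatrix_add]; rfl⟩
  zero_mem' := ⟨0, by rw [Matrix.zero_kronecker, Matrix.submatrix_zero]; rfl⟩
  smul_mem' := by
    rintro c _ ⟨a, rfl⟩
    exact ⟨c • a, by rw [Matrix.smul_kronecker, Matrix.submatrix_smul]; rfl⟩

theorem SupportedOn.mul {A B : Op d} {S : Finset (Fin N)} (hA : SupportedOn A S)
    (hB : SupportedOn B S) : SupportedOn (A * B) S := by
  obtain ⟨a, rfl⟩ := hA
  obtain ⟨b, rfl⟩ := hB
  exact ⟨a * b, by rw [Matrix.submatrix_mul_equiv, ← Matrix.mul_kronecker_mul, Matrix.one_mul]⟩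

theorem SupportedOn.opComm {A B : Op d} {S : Finset (Fin N)} (hA : SupportedOn A S)
    (hB : SupportedOn B S) : SupportedOn (opComm A B) S :=
  (supportedSubmodule d S).sub_mem (hA.mul hB) (hB.mul hA)

theorem SupportedOn.mono {A : Op d} {S S' : Finset (Fin N)} (hA : SupportedOn A S)
    (hS : S ⊆ S') : SupportedOn A S' := by
  rw [supportedOn_iff] at hA ⊢
  refine ⟨fun x y ⟨i, hi, hne⟩ => hA.1 x y ⟨i, fun h => hi (hS h), hne⟩, ?_⟩
  intro x y x' y' h h' hx hy
  by_cases hxy : ∃ i, i ∉ S ∧ x i ≠ y i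
  · rw [hA.1 x y hxy, hA.1 x' y']
    obtain ⟨i, hi, hne⟩ := hxy
    have hi' : i ∈ S' := by
      by_contra hi'
      exact hne (h i hi')
    exact ⟨i, hi, by rwa [← hx i hi', ← hy i hi']⟩
  · push Not at hxy
    refine hA.2 x y x' y' hxy (fun i hi => ?_) (fun i hi => hx i (hS hi)) (fun i hi => hy i (hS hi))
    by_cases hi' : i ∈ S'
    · rw [← hx i hi', ← hy i hi', hxy i hi]
    · exact h' i hi'

/-- Operators with disjoint supports commute: in both products the only contributing intermediate
configuration is the one that agrees with one index on the one support and with the other index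
elsewhere. -/
theorem SupportedOn.commute {A B : Op d} {S S' : Finset (Fin N)} (hA : SupportedOn A S)
    (hB : SupportedOn B S') (hdisj : Disjoint S S') : A * B = B * A := by
  rw [supportedOn_iff] at hA hB
  rw [Finset.disjoint_left] at hdisj
  ext x y
  set z : ∀ i, Fin (d i) := fun i => if i ∈ S then y i else x i with hz
  set w : ∀ i, Fin (d i) := fun i => if i ∈ S then x i else y i with hw
  have hAB : (A * B) x y = A x z * B z y := by
    rw [Matrix.mul_apply]
    refine Finset.sum_eq_single z (fun v _ hv => ?_) (fun h => absurd (Finset.mem_univ _) h)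
    obtain ⟨i, hi⟩ := Function.ne_iff.1 hv
    simp only [hz] at hi
    split_ifs at hi with his
    · rw [hB.1 v y ⟨i, hdisj his, hi⟩, mul_zero]
    · rw [hA.1 x v ⟨i, his, Ne.symm hi⟩, zero_mul]
  have hBA : (B * A) x y = B x w * A w y := by
    rw [Matrix.mul_apply]
    refine Finset.sum_eq_single w (fun v _ hv => ?_) (fun h => absurd (Finset.mem_univ _) h)
    obtain ⟨i, hi⟩ := Function.ne_iff.1 hv
    simp only [hw] at hi
    split_ifs at hi with his
    · rw [hB.1 x v ⟨i, hdisj his, Ne.symm hi⟩, zero_mul]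
    · rw [hA.1 v y ⟨i, his, hi⟩, mul_zero]
  have h1 : A x z = A w y := hA.2 x z w y (fun i hi => by simp [hz, hi])
    (fun i hi => by simp [hw, hi]) (fun i hi => by simp [hw, hi]) (fun i hi => by simp [hz, hi])
  have h2 : B z y = B x w := by
    by_cases h : ∃ i, i ∉ S' ∧ z i ≠ y i
    · rw [hB.1 z y h, hB.1 x w]
      obtain ⟨i, hi, hne⟩ := h
      refine ⟨i, hi, ?_⟩
      by_cases his : i ∈ S
      · simp [hz, his] at hne
      · simpa [hz, hw, his] using hne
    · push Not at h
      refine hB.2 z y x w h (fun i hi => ?_) (fun i hi => ?_) (fun i hi => ?_)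
      · by_cases his : i ∈ S
        · simp [hw, his]
        · simpa [hz, hw, his] using h i hi
      · have his : i ∉ S := fun his => hdisj his hi
        simp [hz, his]
      · have his : i ∉ S := fun his => hdisj his hi
        simp [hw, his]
  rw [hAB, hBA, h1, h2, mul_comm]

/-! ### The bracket of families of local terms -/

/-- The families of local terms of range `r`. -/
def rangeSubmodule (d : Fin N → ℕ) (r : ℕ) : Submodule ℂ (Fin N → Op d) :=
  Submodule.pi Set.univ fun i => supportedSubmodule d (siteInterval i r)

theorem mem_rangeSubmodule {A : Fin N → Op d} {r : ℕ} :
    A ∈ rangeSubmodule d r ↔ ∀ i, SupportedOn (A i) (siteInterval i r) := by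
  rw [rangeSubmodule, Submodule.mem_pi]
  exact ⟨fun h i => h i (Set.mem_univ i), fun h i _ => h i⟩

theorem mem_siteInterval {i j : Fin N} {r : ℕ} :
    j ∈ siteInterval i r ↔ (i : ℕ) ≤ j ∧ (j : ℕ) < i + r := by
  rw [siteInterval, Finset.mem_filter]
  exact ⟨fun h => h.2, fun h => ⟨Finset.mem_univ j, h⟩⟩

theorem card_siteInterval_le (i : Fin N) (r : ℕ) : (siteInterval i r).card ≤ r := by
  calc (siteInterval i r).card ≤ (Finset.Ico (i : ℕ) (i + r)).card :=
        Finset.card_le_card_of_injOn (fun j : Fin N => (j : ℕ))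
          (fun j hj => by
            rw [Finset.mem_coe, mem_siteInterval] at hj
            simpa using hj)
          fun a _ b _ h => Fin.ext h
    _ = r := by simp

theorem opComm_eq_zero {A B : Op d} {i j : Fin N} {a b : ℕ} (hA : SupportedOn A (siteInterval i a))
    (hB : SupportedOn B (siteInterval j b)) (h : (i : ℕ) + a ≤ j ∨ (j : ℕ) + b ≤ i) :
    opComm A B = 0 := by
  refine sub_eq_zero.2 (hA.commute hB (Finset.disjoint_left.2 fun x hx hx' => ?_))
  rw [mem_siteInterval] at hx hx'
  omega

theorem norm_opComm_le (A B : Op d) : ‖opComm A B‖ ≤ 2 * (‖A‖ * ‖B‖) := by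
  have h1 := norm_sub_le (A * B) (B * A)
  have h2 := Matrix.l2_opNorm_mul A B
  have h3 := Matrix.l2_opNorm_mul B A
  rw [opComm]
  linarith [mul_comm ‖A‖ ‖B‖]

theorem localBracket_mem {A B : Fin N → Op d} {a b : ℕ} (hA : A ∈ rangeSubmodule d a)
    (hB : B ∈ rangeSubmodule d b) : localBracket A B ∈ rangeSubmodule d (a + b) := by
  rw [mem_rangeSubmodule] at hA hB ⊢
  intro k
  refine (supportedSubmodule d (siteInterval k (a + b))).sum_mem fun p hp => ?_
  obtain ⟨i, j⟩ := p
  have hk : min (i : ℕ) (j : ℕ) = k := by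
    rw [Finset.mem_filter] at hp
    rw [← hp.2]
    exact (Fin.coe_min i j).symm
  by_cases h : (i : ℕ) + a ≤ j ∨ (j : ℕ) + b ≤ i
  · rw [opComm_eq_zero (hA i) (hB j) h]
    exact Submodule.zero_mem _
  · refine ((hA i).mono fun x hx => ?_).opComm ((hB j).mono fun x hx => ?_) <;>
      rw [mem_siteInterval] at * <;> omega

/-- A local term of a commutator collects at most `a + b` nonzero commutators of local terms. -/
theorem norm_localBracket_le {A B : Fin N → Op d} {a b : ℕ} (hA : A ∈ rangeSubmodule d a)
    (hB : B ∈ rangeSubmodule d b) : ‖localBracket A B‖ ≤ 2 * ((a : ℝ) + b) * (‖A‖ * ‖B‖) := by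
  rw [mem_rangeSubmodule] at hA hB
  rw [pi_norm_le_iff_of_nonneg (by positivity)]
  intro k
  set D : Finset (Fin N × Fin N) := (siteInterval k a).image (fun j => (k, j)) ∪
    (siteInterval k b).image (fun i => (i, k)) with hD
  have hcard : D.card ≤ a + b :=
    (Finset.card_union_le _ _).trans (add_le_add
      (Finset.card_image_le.trans (card_siteInterval_le k a))
      (Finset.card_image_le.trans (card_siteInterval_le k b)))
  have hzero : ∀ p : Fin N × Fin N, min p.1 p.2 = k → p ∉ D → opComm (A p.1) (B p.2) = 0 := by
    rintro ⟨i, j⟩ hk hp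
    refine opComm_eq_zero (hA i) (hB j) ?_
    by_contra h
    push Not at h
    refine hp ?_
    rcases le_total i j with hij | hij
    · rw [min_eq_left hij] at hk
      subst hk
      exact Finset.mem_union_left _ (Finset.mem_image_of_mem _
        (mem_siteInterval.2 ⟨Fin.le_def.1 hij, h.1⟩))
    · rw [min_eq_right hij] at hk
      subst hk
      exact Finset.mem_union_right _ (Finset.mem_image.2
        ⟨i, mem_siteInterval.2 ⟨Fin.le_def.1 hij, h.2⟩, rfl⟩)
  have hnorm : ∀ p : Fin N × Fin N, ‖opComm (A p.1) (B p.2)‖ ≤ 2 * (‖A‖ * ‖B‖) := fun p => by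
    refine (norm_opComm_le _ _).trans ?_
    gcongr
    · exact norm_le_pi_norm A _
    · exact norm_le_pi_norm B _
  calc ‖localBracket A B k‖ ≤ ∑ p ∈ (Finset.univ : Finset (Fin N × Fin N)) with min p.1 p.2 = k,
        ‖opComm (A p.1) (B p.2)‖ := norm_sum_le _ _
    _ ≤ ∑ p ∈ D, ‖opComm (A p.1) (B p.2)‖ := by
        rw [← Finset.sum_filter_add_sum_filter_not _ (fun p => p ∈ D)]
        rw [Finset.sum_eq_zero (s := Finset.filter (fun p => p ∉ D) _), add_zero]
        · exact Finset.sum_le_sum_of_subset_of_nonneg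
            (fun p hp => (Finset.mem_filter.1 hp).2) fun _ _ _ => norm_nonneg _
        · intro p hp
          simp only [Finset.mem_filter] at hp
          rw [hzero p hp.1.2 hp.2, norm_zero]
    _ ≤ ∑ _p ∈ D, 2 * (‖A‖ * ‖B‖) := Finset.sum_le_sum fun p _ => hnorm p
    _ = D.card * (2 * (‖A‖ * ‖B‖)) := by rw [Finset.sum_const, nsmul_eq_mul]
    _ ≤ ((a : ℝ) + b) * (2 * (‖A‖ * ‖B‖)) := by
        gcongr
        exact_mod_cast hcard
    _ = _ := by ring

/-- `localBracket` as a continuous bilinear map. -/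
def localBracketL (d : Fin N → ℕ) :
    (Fin N → Op d) →L[ℂ] (Fin N → Op d) →L[ℂ] (Fin N → Op d) :=
  (LinearMap.mk₂ ℂ localBracket
    (fun A A' B => by
      funext k
      simp only [localBracket, opComm, Pi.add_apply, ← Finset.sum_add_distrib]
      exact Finset.sum_congr rfl fun p _ => by noncomm_ring)
    (fun c A B => by
      funext k
      simp only [localBracket, opComm, Pi.smul_apply, Finset.smul_sum]
      exact Finset.sum_congr rfl fun p _ => by
        rw [Matrix.smul_mul, Matrix.mul_smul, smul_sub])
    (fun A B B' => by
      funext k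
      simp only [localBracket, opComm, Pi.add_apply, ← Finset.sum_add_distrib]
      exact Finset.sum_congr rfl fun p _ => by noncomm_ring)
    (fun c A B => by
      funext k
      simp only [localBracket, opComm, Pi.smul_apply, Finset.smul_sum]
      exact Finset.sum_congr rfl fun p _ => by
        rw [Matrix.smul_mul, Matrix.mul_smul, smul_sub])).toContinuousBilinearMap

theorem localBracketL_apply (A B : Fin N → Op d) : localBracketL d A B = localBracket A B := rfl

/-- `total` as a continuous linear map. -/
def totalL (d : Fin N → ℕ) : (Fin N → Op d) →L[ℂ] Op d :=
  ∑ i, ContinuousLinearMap.proj i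

theorem totalL_apply (A : Fin N → Op d) : totalL d A = total A := by
  simp [totalL, total]

theorem total_localBracket (A B : Fin N → Op d) :
    total (localBracket A B) = opComm (total A) (total B) := by
  simp only [total, localBracket]
  rw [Finset.sum_fiberwise, Fintype.sum_prod_type, opComm, Finset.sum_mul_sum, Finset.sum_mul_sum,
    Finset.sum_comm (f := fun i j => B i * A j), ← Finset.sum_sub_distrib]
  refine Finset.sum_congr rfl fun i _ => ?_
  rw [← Finset.sum_sub_distrib]
  rfl

/-! ### The local norm -/

theorem localNorm_le_ofReal_iff {B : ℝ → Fin N → Op d} {c : ℝ} (hc : 0 ≤ c) :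
    localNorm B ≤ ENNReal.ofReal c ↔ ∀ t, ‖B t‖ ≤ c := by
  simp only [localNorm, iSup_le_iff, ← ofReal_norm, ENNReal.ofReal_le_ofReal_iff hc,
    pi_norm_le_iff_of_nonneg hc]
  exact forall_comm

theorem exists_localNorm_eq_ofReal {B : ℝ → Fin N → Op d} {C : ℝ} (hC : ∀ t, ‖B t‖ ≤ C) :
    ∃ c, 0 ≤ c ∧ localNorm B = ENNReal.ofReal c ∧ ∀ t, ‖B t‖ ≤ c := by
  have hC0 : 0 ≤ C := (norm_nonneg _).trans (hC 0)
  have hne : localNorm B ≠ ⊤ :=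
    ne_top_of_le_ne_top ENNReal.ofReal_ne_top ((localNorm_le_ofReal_iff hC0).2 hC)
  have heq : localNorm B = ENNReal.ofReal (localNorm B).toReal := (ENNReal.ofReal_toReal hne).symm
  exact ⟨_, ENNReal.toReal_nonneg, heq,
    (localNorm_le_ofReal_iff ENNReal.toReal_nonneg).1 heq.le⟩

theorem hasRange_iff {B : ℝ → Fin N → Op d} {r : ℕ} :
    HasRange B r ↔ ∀ t, B t ∈ rangeSubmodule d r :=
  forall_congr' fun _ => mem_rangeSubmodule.symm

end Chain

/-! ### Locality estimates for the recursion -/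

section Estimates

variable {N : ℕ} {d : Fin N → ℕ}

/-- Each commutator with `Ω_a` contributes its norm and, by locality, twice the range of the result;
`nestWeight` collects the factorials and the ranges in units of `R`. -/
theorem nestSum_mem_and_norm_le {R q m : ℕ} {α γ β : ℝ} {Ω : ℕ → Fin N → Op d} {B : Fin N → Op d}
    (hγ : 0 ≤ γ) (hα : 0 ≤ α)
    (hΩ : ∀ p, 1 ≤ p → p ≤ q →
      Ω p ∈ rangeSubmodule d (R * p) ∧ ‖Ω p‖ ≤ α * γ ^ p * (p - 1).factorial)
    (hB : B ∈ rangeSubmodule d (R * m)) (hBβ : ‖B‖ ≤ β * (m - 1).factorial) (k s : ℕ)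
    (hs : s ≤ q) :
    nestSum localBracket Ω k s B ∈ rangeSubmodule d (R * (m + s)) ∧
      ‖nestSum localBracket Ω k s B‖ ≤ β * (2 * R * α) ^ k * γ ^ s * nestWeight k m s := by
  induction k generalizing s with
  | zero =>
    rw [nestSum_zero, nestWeight]
    split_ifs with h
    · subst h
      exact ⟨hB, by simpa using hBβ⟩
    · exact ⟨Submodule.zero_mem _, by simp⟩
  | succ k ih =>
    have hrec : nestSum localBracket Ω (k + 1) s B = ∑ a ∈ Finset.Icc 1 s,
        localBracket (Ω a) (nestSum localBracket Ω k (s - a) B) :=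
      nestSum_succ (localBracketL d) Ω k s B
    rw [hrec]
    constructor
    · refine Submodule.sum_mem _ fun a ha => ?_
      rw [Finset.mem_Icc] at ha
      have h := localBracket_mem (hΩ a ha.1 (ha.2.trans hs)).1 (ih (s - a) (by omega)).1
      rwa [← Nat.mul_add, show a + (m + (s - a)) = m + s by omega] at h
    · refine (norm_sum_le _ _).trans ?_
      rw [nestWeight, Finset.mul_sum, Finset.mul_sum]
      refine Finset.sum_le_sum fun a ha => ?_
      rw [Finset.mem_Icc] at ha
      obtain ⟨h1, h2⟩ := hΩ a ha.1 (ha.2.trans hs)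
      obtain ⟨h3, h4⟩ := ih (s - a) (by omega)
      calc _ ≤ 2 * (((R * a : ℕ) : ℝ) + ((R * (m + (s - a)) : ℕ) : ℝ)) *
            (‖Ω a‖ * ‖nestSum localBracket Ω k (s - a) B‖) := norm_localBracket_le h1 h3
        _ = 2 * (R * ((m : ℝ) + s)) * (‖Ω a‖ * ‖nestSum localBracket Ω k (s - a) B‖) := by
            rw [← Nat.cast_add, ← Nat.mul_add, show a + (m + (s - a)) = m + s by omega]
            push_cast
            ring
        _ ≤ 2 * (R * ((m : ℝ) + s)) * ((α * γ ^ a * (a - 1).factorial) *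
            (β * (2 * R * α) ^ k * γ ^ (s - a) * nestWeight k m (s - a))) := by gcongr
        _ = _ := by
            rw [← pow_sub_mul_pow γ ha.2]
            ring

/-- The inductive step. In the estimate a `k`-fold commutator costs `(2 * R * α) ^ k` times a
`nestWeight`, which is at most `6 ^ k` after summation; with `36 * R * α ≤ 1` each of the two sums in
the recursion is therefore bounded by `∑_{k ≥ 1} 3⁻ᵏ = 1 / 2` of the claimed value. -/
theorem norm_gaugeStep_le {R q : ℕ} {α γ h : ℝ} {H : ℝ → Fin N → Op d}
    {Ω V : ℕ → ℝ → Fin N → Op d} (hγ : 0 ≤ γ) (hα : 0 ≤ α) (hh : 0 ≤ h) (hRα : 36 * (R * α) ≤ 1)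
    (hHr : ∀ t, H t ∈ rangeSubmodule d R) (hH : ∀ t, ‖H t‖ ≤ h)
    (hΩ : ∀ p, 1 ≤ p → p ≤ q → ∀ t,
      Ω p t ∈ rangeSubmodule d (R * p) ∧ ‖Ω p t‖ ≤ α * γ ^ p * (p - 1).factorial)
    (hV : ∀ p, p < q → ∀ t, V p t ∈ rangeSubmodule d (R * (p + 1)) ∧
      ‖V p t‖ ≤ 2 * (p.factorial * h * γ ^ p)) (t : ℝ) :
    gaugeStep localBracket H Ω V q t ∈ rangeSubmodule d (R * (q + 1)) ∧
      ‖gaugeStep localBracket H Ω V q t‖ ≤ q.factorial * h * γ ^ q := by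
  set x : ℝ := 2 * R * α with hx
  have hx0 : 0 ≤ x := by positivity
  have hx1 : 6 * x ≤ 1 / 3 := by rw [hx]; linarith
  have hΩt : ∀ p, 1 ≤ p → p ≤ q →
      Ω p t ∈ rangeSubmodule d (R * p) ∧ ‖Ω p t‖ ≤ α * γ ^ p * (p - 1).factorial :=
    fun p h1 h2 => hΩ p h1 h2 t
  have hHn : ∀ k, nestSum localBracket (fun p => Ω p t) k q (H t) ∈
      rangeSubmodule d (R * (q + 1)) ∧
      ‖nestSum localBracket (fun p => Ω p t) k q (H t)‖ ≤ h * x ^ k * γ ^ q * nestWeight k 1 q := by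
    intro k
    rw [add_comm q 1]
    exact nestSum_mem_and_norm_le hγ hα hΩt (by simpa using hHr t) (by simpa using hH t) k q le_rfl
  have hVn : ∀ m ∈ Finset.Icc 1 q, ∀ k,
      nestSum localBracket (fun p => Ω p t) k (q + 1 - m) (V (m - 1) t) ∈
        rangeSubmodule d (R * (q + 1)) ∧
      ‖nestSum localBracket (fun p => Ω p t) k (q + 1 - m) (V (m - 1) t)‖ ≤
        2 * (h * γ ^ q) * (x ^ k * nestWeight k m (q + 1 - m)) := by
    intro m hm k
    rw [Finset.mem_Icc] at hm
    obtain ⟨h1, h2⟩ := hV (m - 1) (by omega) t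
    rw [Nat.sub_add_cancel hm.1] at h1
    obtain ⟨h3, h4⟩ := nestSum_mem_and_norm_le (q := q) (β := 2 * (h * γ ^ (m - 1))) hγ hα hΩt h1
      (h2.trans_eq (by ring)) k (q + 1 - m) (by omega)
    rw [show m + (q + 1 - m) = q + 1 by omega] at h3
    refine ⟨h3, h4.trans_eq ?_⟩
    have hpow : γ ^ q = γ ^ (m - 1) * γ ^ (q + 1 - m) := by rw [← pow_add]; congr 1; omega
    rw [hpow]
    ring
  have hgeom : ∑ k ∈ Finset.Icc 1 q, (6 * x) ^ k ≤ 1 / 2 := by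
    refine (sum_Icc_pow_le (by positivity) (by linarith) q).trans ?_
    rw [div_le_iff₀ (by linarith)]
    linarith
  have hcoef : ∀ k : ℕ, ‖(-1 : ℂ) ^ k / (k.factorial : ℂ)‖ = 1 / (k.factorial : ℝ) := by
    intro k
    rw [norm_div, norm_pow, norm_neg, norm_one, one_pow, Complex.norm_natCast]
  rw [gaugeStep_eq_nestSum]
  refine ⟨Submodule.add_mem _ (Submodule.sum_mem _ fun k _ => Submodule.smul_mem _ _ (hHn k).1)
    (Submodule.sum_mem _ fun m hm => Submodule.sum_mem _ fun k _ =>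
      Submodule.smul_mem _ _ (hVn m hm k).1), ?_⟩
  have hfirst : ‖∑ k ∈ Finset.Icc 1 q, ((-1 : ℂ) ^ k / (k.factorial : ℂ)) •
      nestSum localBracket (fun p => Ω p t) k q (H t)‖ ≤
      h * γ ^ q * q.factorial * ∑ k ∈ Finset.Icc 1 q, (6 * x) ^ k := by
    refine (norm_sum_le _ _).trans ?_
    rw [Finset.mul_sum]
    refine Finset.sum_le_sum fun k _ => ?_
    have hk : (1 : ℝ) ≤ (k.factorial : ℝ) := by exact_mod_cast k.factorial_pos
    rw [norm_smul, hcoef]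
    calc _ ≤ 1 * (h * x ^ k * γ ^ q * (6 ^ k * (q.factorial : ℝ))) := by
          refine mul_le_mul ((div_le_one (by linarith)).2 hk) ((hHn k).2.trans ?_)
            (norm_nonneg _) zero_le_one
          gcongr
          exact nestWeight_one_le k q
      _ = _ := by rw [mul_pow 6 x]; ring
  have hsecond : ‖∑ m ∈ Finset.Icc 1 q, ∑ k ∈ Finset.Icc 1 (q + 1 - m),
      ((-1 : ℂ) ^ (k + 1) / ((k + 1).factorial : ℂ)) •
        nestSum localBracket (fun p => Ω p t) k (q + 1 - m) (V (m - 1) t)‖ ≤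
      h * γ ^ q * q.factorial * ∑ k ∈ Finset.Icc 1 q, (6 * x) ^ k := by
    calc _ ≤ ∑ m ∈ Finset.Icc 1 q, ∑ k ∈ Finset.Icc 1 q,
          h * γ ^ q * (x ^ k * nestWeight k m (q + 1 - m)) := by
          refine (norm_sum_le _ _).trans (Finset.sum_le_sum fun m hm => ?_)
          have hm' := Finset.mem_Icc.1 hm
          have hterm : ∀ k ∈ Finset.Icc 1 (q + 1 - m),
              ‖((-1 : ℂ) ^ (k + 1) / ((k + 1).factorial : ℂ)) •
                nestSum localBracket (fun p => Ω p t) k (q + 1 - m) (V (m - 1) t)‖ ≤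
              h * γ ^ q * (x ^ k * nestWeight k m (q + 1 - m)) := by
            intro k hk
            -- Here `k ≥ 1`, so `1 / (k + 1)!` absorbs the factor `2` from the bound on `V`.
            have hk2 : (2 : ℝ) ≤ ((k + 1).factorial : ℝ) := by
              exact_mod_cast (Nat.factorial_le (show 2 ≤ k + 1 by
                rw [Finset.mem_Icc] at hk; omega) : (2).factorial ≤ _)
            rw [norm_smul, hcoef, one_div_mul_eq_div, div_le_iff₀ (by linarith)]
            refine (hVn m hm k).2.trans ?_
            have h0 : 0 ≤ h * γ ^ q * (x ^ k * nestWeight k m (q + 1 - m)) :=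
              mul_nonneg (by positivity) (mul_nonneg (by positivity) (nestWeight_nonneg _ _ _))
            nlinarith
          refine (norm_sum_le _ _).trans ((Finset.sum_le_sum hterm).trans ?_)
          refine Finset.sum_le_sum_of_subset_of_nonneg
            (Finset.Icc_subset_Icc_right (by omega)) fun k _ _ => ?_
          exact mul_nonneg (by positivity) (mul_nonneg (by positivity) (nestWeight_nonneg _ _ _))
      _ = h * γ ^ q * ∑ k ∈ Finset.Icc 1 q, x ^ k *
          ∑ m ∈ Finset.Icc 1 q, nestWeight k m (q + 1 - m) := by
          rw [Finset.sum_comm]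
          simp only [Finset.mul_sum]
      _ ≤ h * γ ^ q * ∑ k ∈ Finset.Icc 1 q, x ^ k * (6 ^ k * (q.factorial : ℝ)) := by
          gcongr with k hk
          refine le_trans ?_ (sum_nestWeight_le k q)
          exact Finset.sum_le_sum_of_subset_of_nonneg (Finset.Icc_subset_Icc_right (by omega))
            fun m _ _ => nestWeight_nonneg _ _ _
      _ = _ := by
          rw [mul_assoc (h * γ ^ q), Finset.mul_sum (a := (q.factorial : ℝ))]
          congr 1
          exact Finset.sum_congr rfl fun k _ => by rw [mul_pow 6 x]; ring
  have h0 : 0 ≤ h * γ ^ q * q.factorial := by positivity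
  refine (norm_add_le _ _).trans ?_
  nlinarith

/-- The constant `72` is what makes the prefactor `α = 2 / (72 * R)` in the bound
`‖Ω_p‖ ≤ α (72 R h T) ^ p (p - 1)!` satisfy `36 * R * α = 1`. -/
theorem gaugeG_mem_and_norm_le {R : ℕ} {h T : ℝ} {H : ℝ → Fin N → Op d} (hR : 1 ≤ R)
    (hh : 0 ≤ h) (hT : 0 < T) (hHT : H ∈ bddPeriodic (Fin N → Op d) T)
    (hHr : ∀ t, H t ∈ rangeSubmodule d R) (hH : ∀ t, ‖H t‖ ≤ h) (q : ℕ) (t : ℝ) :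
    gaugeG localBracket T H q t ∈ rangeSubmodule d (R * (q + 1)) ∧
      ‖gaugeG localBracket T H q t‖ ≤ q.factorial * h * (72 * R * h * T) ^ q := by
  have hR' : (0 : ℝ) < R := by exact_mod_cast hR
  have hG : ∀ p, gaugeG localBracket T H p ∈ bddPeriodic (Fin N → Op d) T :=
    gaugeG_mem_bddPeriodic (localBracketL d) hT hHT
  induction q using Nat.strong_induction_on generalizing t with
  | _ q ih =>
    rcases Nat.eq_zero_or_pos q with rfl | hq
    · rw [gaugeG_zero]
      exact ⟨by simpa using hHr t, by simpa using hH t⟩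
    · rw [gaugeG_of_pos _ _ _ hq]
      have hV : ∀ p, p < q → ∀ t, gaugeV localBracket T H p t ∈ rangeSubmodule d (R * (p + 1)) ∧
          ‖gaugeV localBracket T H p t‖ ≤ 2 * (p.factorial * h * (72 * R * h * T) ^ p) :=
        fun p hp t => ⟨oscPart_mem _ (hG p) (fun s => (ih p hp s).1) t,
          norm_oscPart_le hT (fun s => (ih p hp s).2) t⟩
      refine norm_gaugeStep_le (α := 2 / (72 * R)) (by positivity) (by positivity) hh
        (le_of_eq (by field_simp; norm_num)) hHr hH (fun p h1 h2 t => ?_) hV t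
      obtain ⟨p, rfl⟩ : ∃ r, p = r + 1 := ⟨p - 1, by omega⟩
      refine ⟨generator_mem _ (hG p) (fun s => (ih p (by omega) s).1) t,
        (norm_generator_le hT (hG p) (fun s => (hV p (by omega) s).2) t).trans_eq ?_⟩
      rw [Nat.add_sub_cancel, pow_succ]
      field_simp

end Estimates

end FloquetGauge

end

open FloquetGauge in
theorem mainTheorem1 :
    (∃ C₀ : ℝ, 0 < C₀ ∧
      ∀ (N : ℕ) (d : Fin N → ℕ) (R : ℕ) (h T : ℝ) (H : ℝ → Fin N → Op d),
        1 ≤ R → 0 ≤ h → 0 < T →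
        MeasureTheory.StronglyMeasurable H →
        Function.Periodic H T →
        HasRange H R →
        localNorm H ≤ ENNReal.ofReal h →
        ∀ q : ℕ,
          -- the local terms add up to the operators of the gauge transformation of `∑_i H_i(t)`
          (∀ t, total (gaugeG localBracket T H q t) = gaugeG opComm T (fun s => total (H s)) q t) ∧
          total (gaugeHbar localBracket T H q) = gaugeHbar opComm T (fun s => total (H s)) q ∧
          (∀ t, total (gaugeV localBracket T H q t) = gaugeV opComm T (fun s => total (H s)) q t) ∧
          (∀ t, total (gaugeΩ localBracket T H (q + 1) t) =
            gaugeΩ opComm T (fun s => total (H s)) (q + 1) t) ∧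
          -- periodicity, and `i ∂_t Ω_{q+1} = V^{(q)}`
          Function.Periodic (gaugeG localBracket T H q) T ∧
          Function.Periodic (gaugeV localBracket T H q) T ∧
          Function.Periodic (gaugeΩ localBracket T H (q + 1)) T ∧
          (∀ t, ContinuousAt H t → HasDerivAt (gaugeΩ localBracket T H (q + 1))
            ((-Complex.I) • gaugeV localBracket T H q t) t) ∧
          -- ranges
          HasRange (gaugeG localBracket T H q) (R * (q + 1)) ∧
          HasRange (fun _ => gaugeHbar localBracket T H q) (R * (q + 1)) ∧
          HasRange (gaugeV localBracket T H q) (R * (q + 1)) ∧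
          HasRange (gaugeΩ localBracket T H (q + 1)) (R * (q + 1)) ∧
          -- local norms
          localNorm (gaugeG localBracket T H q) ≤
            ENNReal.ofReal ((q.factorial : ℝ) * h * (C₀ * R * h * T) ^ q) ∧
          localNorm (fun _ => gaugeHbar localBracket T H q) ≤
            localNorm (gaugeG localBracket T H q) ∧
          localNorm (gaugeV localBracket T H q) ≤ 2 * localNorm (gaugeG localBracket T H q) ∧
          localNorm (gaugeΩ localBracket T H (q + 1)) ≤
            ENNReal.ofReal T * localNorm (gaugeV localBracket T H q) ∧
          ENNReal.ofReal T * localNorm (gaugeV localBracket T H q) ≤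
            ENNReal.ofReal (2 * (C₀ * R) ^ q * (q.factorial : ℝ) * (h * T) ^ (q + 1))) ∧
    -- the combinatorial lemma
    (∃ C₀ : ℝ, 0 < C₀ ∧ ∀ R q : ℕ, 1 ≤ R →
      1 / (q.factorial : ℝ) * ∑ n ∈ Finset.Icc 2 (q + 1),
        (C₀ * R) ^ (-(n : ℤ)) / (n.factorial : ℝ) * overlapSum R q n ≤ 1) := by
  refine ⟨⟨72, by norm_num, ?_⟩, 12, by norm_num, fun R q hR => sum_overlapSum_le hR q⟩
  intro N d R h T H hR hh hT hHm hHp hHr hHn q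
  rw [localNorm_le_ofReal_iff hh] at hHn
  rw [hasRange_iff] at hHr
  have hHT : H ∈ bddPeriodic (Fin N → Op d) T := ⟨hHm, ⟨h, hHn⟩, hHp⟩
  have hG : gaugeG localBracket T H q ∈ bddPeriodic (Fin N → Op d) T :=
    gaugeG_mem_bddPeriodic (localBracketL d) hT hHT q
  have hGb := gaugeG_mem_and_norm_le hR hh hT hHT hHr hHn q
  have hGr := fun t => (hGb t).1
  have hGn := fun t => (hGb t).2
  have htot : (fun t => total (gaugeG localBracket T H q t)) =
      gaugeG opComm T (fun s => total (H s)) q := by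
    have hL := map_gaugeG (localBracketL d) (totalL d) (br' := opComm)
      (fun A B => by simp only [totalL_apply, localBracketL_apply, total_localBracket]) hT hHT q
    simpa only [totalL_apply, localBracketL_apply] using hL
  have htot' : (fun t => totalL d (gaugeG localBracket T H q t)) =
      gaugeG opComm T (fun s => total (H s)) q := by
    simpa only [totalL_apply] using htot
  obtain ⟨g, hg0, hg, hgG⟩ := exists_localNorm_eq_ofReal hGn
  obtain ⟨v, hv0, hv, hvV⟩ := exists_localNorm_eq_ofReal
    (B := gaugeV localBracket T H q) (norm_oscPart_le hT hGn)
  have hle : v ≤ 2 * (q.factorial * h * (72 * R * h * T) ^ q) := by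
    have h0 : 0 ≤ 2 * (q.factorial * h * (72 * R * h * T) ^ q) := by positivity
    rw [← ENNReal.ofReal_le_ofReal_iff h0, ← hv, localNorm_le_ofReal_iff h0]
    exact norm_oscPart_le hT hGn
  refine ⟨fun t => congrFun htot t, ?_, fun t => ?_, fun t => ?_, hG.2.2,
    (oscPart_mem_bddPeriodic hG).2.2, periodic_generator hT hG,
    fun t ht => hasDerivAt_generator hG (continuousAt_gaugeG (localBracketL d) hT hHT ht q),
    hasRange_iff.2 hGr, hasRange_iff.2 fun _ => timeAvg_mem _ hG hGr,
    hasRange_iff.2 (oscPart_mem _ hG hGr), hasRange_iff.2 (generator_mem _ hG hGr),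
    (localNorm_le_ofReal_iff (by positivity)).2 hGn, ?_, ?_, ?_, ?_⟩
  · rw [gaugeHbar, gaugeHbar, ← totalL_apply, map_timeAvg _ hG, htot']
  · rw [gaugeV, gaugeV, ← totalL_apply, map_oscPart _ hG, htot']
  · rw [gaugeΩ, gaugeΩ, Nat.add_sub_cancel, ← totalL_apply, map_generator _ hG, htot']
  · rw [hg, localNorm_le_ofReal_iff hg0]
    exact fun _ => norm_timeAvg_le hT hgG
  · rw [hg, ← ENNReal.ofReal_ofNat 2, ← ENNReal.ofReal_mul zero_le_two,
      localNorm_le_ofReal_iff (by positivity)]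
    exact norm_oscPart_le hT hgG
  · rw [hv, ← ENNReal.ofReal_mul hT.le, localNorm_le_ofReal_iff (by positivity)]
    exact norm_generator_le hT hG hvV
  · rw [hv, ← ENNReal.ofReal_mul hT.le]
    refine ENNReal.ofReal_le_ofReal ((mul_le_mul_of_nonneg_left hle hT.le).trans_eq ?_)
    rw [show 72 * (R : ℝ) * h * T = 72 * R * (h * T) by ring, mul_pow, pow_succ (h * T)]
    ring
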